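/- **Setting.** Let $\vec C_N$ be the directed cycle with vertices $0,\dots,N-1$ and arcs $(e,e+1)$ (mod $N$). A *request tournament* $T_N$ consists of all arcs $(i,i+q)$, $1\le q\le\frac{N-1}{2}$ (mod $N$), and, if $N$ is even, of exactly one of the arcs $(i,i+\frac N2)$, $(i+\frac N2,i)$ for each antipodal pair. The load of a digraph $B$ on an arc $e$ of $\vec C_N$ is the number of arcs $(u,v)$ of $B$ such that the dipath of $\vec C_N$ from $u$ to $v$ contains $e$. A *valid partition* of a set of arcs for the grooming factor $C$ is a partition of it into digraphs (each with a vertex set containing the ends of its arcs) of load at most $C$ on every arc of $\vec C_N$; its cost (number of ADMs) is the sum of the numbers of vertices of the digraphs. $A(C,N)$ is the minimum cost of a valid partition of a request tournament $T_N$. **The digraphs.** $G_6$ has vertices $x_1,\dots,x_6$ and arcs $x_1x_2,x_2x_3,x_1x_3,\ x_3x_4,x_4x_5,x_3x_5,\ x_5x_6,x_6x_1,x_5x_1$. $G_5$ has vertices $x_1,\dots,x_5$ and arcs $x_1x_2,x_2x_5,x_5x_1,\ x_1x_3,x_3x_4,x_4x_1$. For a $K_{4,4,4}$ with classes $\{\ell_A,\ell_B,\ell_C,\ell_D\}$,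 $\ell=1,2,3$, take four $G_6$'s with $(x_1,\dots,x_6)$ equal to $(1_A,2_A,3_B,1_C,2_C,3_D)$, $(1_B,2_B,3_B,1_D,2_D,3_D)$, $(1_B,2_C,3_C,1_D,2_A,3_A)$, $(1_A,3_A,2_B,1_C,3_C,2_D)$ and two $G_5$'s with $(x_1,\dots,x_5)$ equal to $(3_A,1_C,2_C,1_D,2_D)$, $(3_D,2_A,2_B,1_D,1_C)$. **The construction.** Let $t\in\{0,1\}$, let $S$ be a Steiner triple system on $\{1,\dots,p\}$ (a partition of $K_p$ into triangles), and order the $4p+t$ vertices of the ring as $1_A<\dots<p_A<1_B<\dots<p_B<1_C<\dots<p_C<1_D<\dots<p_D$, followed by $\infty$ if $t=1$. Given a request tournament $T$ on these vertices, for each triple $i<j<k$ of $S$ take the four $G_6$'s and two $G_5$'s above with $1,2,3$ replaced by $i,j,k$. For each $i$ partition the arcs of $T$ inside $\{i_A,i_B,i_C,i_D\}$ (together with $\infty$ if $t=1$) into two digraphs: the one with vertex set $\{i_B,i_D\}$ (with $\infty$ if $t=1$) and the arcs of $T$ inside it, and the one with all 4 (or 5) vertices and the remaining arcs. For an arbitrary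 request tournament $T_N$, put $t=N \bmod 2$ and insert at most 14 dummy vertices into the ring, so as to obtain a request tournament extending $T_N$ on $4p+t$ vertices with $p\equiv 1$ or $3\pmod 6$; apply the construction to it with some Steiner triple system on $p$ points; then delete the dummy vertices and all arcs incident with them. **Proposition.** Let $C=2$. 1. On the ring $1_A<2_A<3_A<1_B<\dots<3_D$ with 12 vertices, the four $G_6$'s and two $G_5$'s form a valid partition of $K_{4,4,4}$ oriented along shortest paths, with 34 vertices in total. 2. Steiner triple systems on $p$ points exist for all $p\equiv 1,3\pmod 6$. For every Steiner triple system on $p$ points and every request tournament on $N=4p$ (respectively $N=4p+1$) vertices, the construction without dummy vertices is a valid partition of cost exactly $\frac{34N^2+8N}{96}$ (respectively $\frac{34N^2-12N-22}{96}$). 3. The construction can be carried out for every $N$ and every request tournament $T_N$. There is a constant $K$ such that, for every $N\ge 1$ and every $T_N$, each outcome of the construction is a valid partition of $T_N$ whose cost differs from $\frac{34N^2}{96}$ by at most $KN$. 4. The construction approximates $A(2,N)$ asymptotically within a factor $\frac{34}{33}$: for every $\varepsilon>0$ there is $N_0$ such that for all $N\ge N_0$ and all $T_N$, each outcome has cost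 at most $\left(\frac{34}{33}+\varepsilon\right)A(2,N)$. -/

import Mathlib

/-- A finite digraph with vertices taken from `α`: a vertex set `V` and a set `E` of arcs
with both endpoints in `V`. -/
structure FinDigraph (α : Type*) [DecidableEq α] where
  V : Finset α
  E : Finset (α × α)
  endpoints : ∀ a ∈ E, a.1 ∈ V ∧ a.2 ∈ V

namespace FinDigraph

/-- The image of a digraph under a map of its vertices (a copy of it, if the map is injective on
its vertices). -/
def copy {α β : Type*} [DecidableEq α] [DecidableEq β] (G : FinDigraph α) (x : α → β) :
    FinDigraph β where
  V := G.V.image x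
  E := G.E.image (fun a => (x a.1, x a.2))
  endpoints := by
    intro a ha
    obtain ⟨c, hc, rfl⟩ := Finset.mem_image.mp ha
    exact ⟨Finset.mem_image_of_mem _ (G.endpoints c hc).1,
      Finset.mem_image_of_mem _ (G.endpoints c hc).2⟩

/-- The digraph that remains of `G` when all the vertices outside the range of the injective map
`f` are removed, together with the arcs incident with them. -/
def restrict {α β : Type*} [DecidableEq α] [Fintype α] [DecidableEq β] (G : FinDigraph β)
    (f : α → β) : FinDigraph α where
  V := Finset.univ.filter (fun x => f x ∈ G.V)
  E := Finset.univ.filter (fun a => (f a.1, f a.2) ∈ G.E)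
  endpoints := by
    intro a ha
    have h := G.endpoints _ (Finset.mem_filter.mp ha).2
    exact ⟨Finset.mem_filter.mpr ⟨Finset.mem_univ _, h.1⟩,
      Finset.mem_filter.mpr ⟨Finset.mem_univ _, h.2⟩⟩

end FinDigraph

/-! ### The traffic grooming problem on the unidirectional cycle with vertices `0, …, N - 1` -/

/-- The distance from `u` to `v` along the directed cycle with arcs `(e, e + 1)`, `e ∈ ℤ/N`. -/
def cycleDist {N : ℕ} (u v : Fin N) : ℕ := (v.val + (N - u.val)) % N

/-- The load that `B` puts on the arc `(e, e + 1)` of the cycle: the number of arcs `(u, v)` of `B`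
such that the dipath of the cycle from `u` to `v` contains the arc `(e, e + 1)`. -/
def load {N : ℕ} (B : FinDigraph (Fin N)) (e : Fin N) : ℕ :=
  (B.E.filter (fun a => cycleDist a.1 e < cycleDist a.1 a.2)).card

/-- `B` satisfies the load constraint for the grooming factor `C`. -/
def Admissible {N : ℕ} (C : ℕ) (B : FinDigraph (Fin N)) : Prop :=
  ∀ e : Fin N, load B e ≤ C

/-- `T` is (the arc set of) a request tournament `T_N`: it consists of all the arcs
`(i, i + q)` with `1 ≤ q ≤ (N - 1) / 2` and, when `N` is even, of exactly one of the two arcs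
`(i, i + N / 2)`, `(i + N / 2, i)` for every antipodal pair. -/
structure IsRequestTournament {N : ℕ} (T : Finset (Fin N × Fin N)) : Prop where
  short : ∀ u v : Fin N, u ≠ v → 2 * cycleDist u v < N → (u, v) ∈ T
  antipodal : ∀ u v : Fin N, 2 * cycleDist u v = N → Xor ((u, v) ∈ T) ((v, u) ∈ T)
  only : ∀ u v : Fin N, (u, v) ∈ T → u ≠ v ∧ 2 * cycleDist u v ≤ N

/-- The finite family `B` of digraphs is a valid partition of the arc set `T` for the grooming
factor `C`. -/
structure IsValidPartition {N : ℕ} {ι : Type*} (C : ℕ) (T : Finset (Fin N × Fin N))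
    (B : ι → FinDigraph (Fin N)) : Prop where
  admissible : ∀ w, Admissible C (B w)
  subset : ∀ w, (B w).E ⊆ T
  cover : ∀ a ∈ T, ∃! w, a ∈ (B w).E

/-- The cost (number of ADMs) of a family of digraphs: the total number of vertices. -/
def cost {N : ℕ} {ι : Type*} [Fintype ι] (B : ι → FinDigraph (Fin N)) : ℕ :=
  ∑ w, (B w).V.card

/-- `A(C, N)`: the minimum cost of a valid partition of a request tournament `T_N`. -/
noncomputable def minADM (C N : ℕ) : ℕ :=
  sInf {n | ∃ T : Finset (Fin N × Fin N), IsRequestTournament T ∧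
    ∃ (W : ℕ) (B : Fin W → FinDigraph (Fin N)), IsValidPartition C T B ∧ cost B = n}

/-! ### The digraphs `G₆` and `G₅` and the partition of the oriented `K_{4,4,4}` -/

/-- The digraph `G₆` on `x₁, …, x₆` (numbered from `0` here): three transitively oriented
triangles arranged cyclically. -/
def G6 : FinDigraph (Fin 6) where
  V := Finset.univ
  E := {(0, 1), (1, 2), (0, 2), (2, 3), (3, 4), (2, 4), (4, 5), (5, 0), (4, 0)}
  endpoints := by simp

/-- The digraph `G₅` on `x₁, …, x₅` (numbered from `0` here): the two directed
circuits `x₁ x₂ x₅` and `x₁ x₃ x₄`, which share the vertex `x₁`. -/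
def G5 : FinDigraph (Fin 5) where
  V := Finset.univ
  E := {(0, 1), (1, 4), (4, 0), (0, 2), (2, 3), (3, 0)}
  endpoints := by simp

/-- The positions of `x₁, …, x₆` in the four copies of `G₆`. The pair `(L, c)` stands for the vertex
with letter `L` (`0, 1, 2, 3` for `A, B, C, D`) of the tripartition class `c` (`0, 1, 2` for the
classes `1, 2, 3`). -/
def g6Vertices : Fin 4 → Fin 6 → Fin 4 × Fin 3 :=
  ![![(0, 0), (0, 1), (1, 2), (2, 0), (2, 1), (3, 2)],
    ![(1, 0), (1, 1), (1, 2), (3, 0), (3, 1), (3, 2)],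
    ![(1, 0), (2, 1), (2, 2), (3, 0), (0, 1), (0, 2)],
    ![(0, 0), (0, 2), (1, 1), (2, 0), (2, 2), (3, 1)]]

/-- The positions of `x₁, …, x₅` in the two copies of `G₅`. -/
def g5Vertices : Fin 2 → Fin 5 → Fin 4 × Fin 3 :=
  ![![(0, 2), (2, 0), (2, 1), (3, 0), (3, 1)],
    ![(3, 2), (0, 1), (1, 1), (3, 0), (2, 0)]]

/-- The four `G₆`'s and the two `G₅`'s placed on the twelve vertices `v L c` of a `K_{4,4,4}`. -/
def k444Family {α : Type*} [DecidableEq α] (v : Fin 4 → Fin 3 → α) :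
    Fin 4 ⊕ Fin 2 → FinDigraph α
  | Sum.inl m => G6.copy (fun j => v (g6Vertices m j).1 (g6Vertices m j).2)
  | Sum.inr m => G5.copy (fun j => v (g5Vertices m j).1 (g5Vertices m j).2)

/-- The vertices `1_A < 2_A < 3_A < 1_B < … < 3_D` of the `K_{4,4,4}` on the ring with 12
vertices. -/
def k444Vertex (L : Fin 4) (c : Fin 3) : Fin 12 := ⟨3 * L.val + c.val, by omega⟩

/-- The arcs of the oriented `K_{4,4,4}`: two vertices are joined when they lie in different
tripartition classes, by the arc that follows the shortest path on the ring (antipodal vertices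
lie in the same class). -/
def k444Arcs : Finset (Fin 12 × Fin 12) :=
  Finset.univ.filter (fun a => a.1.val % 3 ≠ a.2.val % 3 ∧ 2 * cycleDist a.1 a.2 < 12)

/-! ### The construction -/

/-- A Steiner triple system on `p` points, that is, a partition of `K_p` into triangles. -/
structure SteinerTripleSystem (p : ℕ) where
  blocks : Finset (Finset (Fin p))
  card_eq : ∀ b ∈ blocks, b.card = 3
  unique : ∀ i j : Fin p, i ≠ j → ∃! b, b ∈ blocks ∧ i ∈ b ∧ j ∈ b

/-- The vertex `i_L` (`L = A, B, C, D`) of the ring with `4 p + t` vertices, in the order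
`1_A < … < p_A < 1_B < … < p_B < 1_C < … < p_C < 1_D < … < p_D`, followed by `t` extra vertices. -/
def ringVertex (p t : ℕ) (L : Fin 4) (i : Fin p) : Fin (4 * p + t) :=
  ⟨L.val * p + i.val, by
    have h := i.isLt
    have hL : L.val * p ≤ 3 * p := Nat.mul_le_mul_right p (by omega)
    omega⟩

/-- The extra vertices: none for `t = 0`, the vertex `∞` for `t = 1`. -/
def extraVertices (p t : ℕ) : Finset (Fin (4 * p + t)) :=
  Finset.univ.filter (fun x => 4 * p ≤ x.val)

/-- The vertices `i_A, i_B, i_C, i_D` and the extra vertices: a `K₄` for `t = 0`, a `K₅` for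
`t = 1`. -/
def column (p t : ℕ) (i : Fin p) : Finset (Fin (4 * p + t)) :=
  Finset.univ.image (fun L => ringVertex p t L i) ∪ extraVertices p t

/-- The vertices `i_B, i_D` and the extra vertices. -/
def smallColumn (p t : ℕ) (i : Fin p) : Finset (Fin (4 * p + t)) :=
  {ringVertex p t 1 i, ringVertex p t 3 i} ∪ extraVertices p t

/-- The partition into two digraphs of the arcs of `T` inside the column of `i`: the arcs inside
`smallColumn p t i` form the second digraph (a single arc for `t = 0`, a triangle for `t = 1`) and
the other arcs form the first one (on 4 vertices with 5 arcs for `t = 0`, on 5 vertices with 7 arcs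
for `t = 1`). -/
def columnFamily {p t : ℕ} (T : Finset (Fin (4 * p + t) × Fin (4 * p + t))) (i : Fin p) :
    Fin 2 → FinDigraph (Fin (4 * p + t)) :=
  ![{ V := column p t i
      E := T.filter (fun a => (a.1 ∈ column p t i ∧ a.2 ∈ column p t i) ∧
        ¬ (a.1 ∈ smallColumn p t i ∧ a.2 ∈ smallColumn p t i))
      endpoints := fun _ ha => (Finset.mem_filter.mp ha).2.1 },
    { V := smallColumn p t i
      E := T.filter (fun a => a.1 ∈ smallColumn p t i ∧ a.2 ∈ smallColumn p t i)
      endpoints := fun _ ha => (Finset.mem_filter.mp ha).2 }]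

/-- The construction on `4 p + t` vertices: for every triple `{i < j < k}` of the Steiner triple
system, four `G₆`'s and two `G₅`'s on the `K_{4,4,4}` with classes `{i_A, i_B, i_C, i_D}`,
`{j_A, j_B, j_C, j_D}`, `{k_A, k_B, k_C, k_D}`; and for every point `i`, two digraphs for the `K₄`
(the `K₅` if `t = 1`) of `i`. The tournament `T` only matters for the choice of the antipodal
arcs. -/
def construction {p t : ℕ} (S : SteinerTripleSystem p)
    (T : Finset (Fin (4 * p + t) × Fin (4 * p + t))) :
    ({b // b ∈ S.blocks} × (Fin 4 ⊕ Fin 2)) ⊕ (Fin p × Fin 2) → FinDigraph (Fin (4 * p + t))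
  | Sum.inl (b, m) => k444Family
      (fun L c => ringVertex p t L (b.1.orderEmbOfFin (S.card_eq b.1 b.2) c)) m
  | Sum.inr (i, m) => columnFamily T i m

/-- A run of the construction for the request tournament `T` on `N` vertices: dummy vertices are
inserted (`f` is the inclusion of the original vertices, in their order on the ring) so as to obtain
a request tournament `T'` on `4 p` (`N` even) or `4 p + 1` (`N` odd) vertices with
`p ≡ 1, 3 (mod 6)`, and a Steiner triple system on `p` points is chosen. At most 14 dummy vertices
are ever needed. -/
structure ConstructionRun (N : ℕ) (T : Finset (Fin N × Fin N)) where
  p : ℕ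
  p_mod : p % 6 = 1 ∨ p % 6 = 3
  dummies : 4 * p + N % 2 ≤ N + 14
  S : SteinerTripleSystem p
  f : Fin N ↪o Fin (4 * p + N % 2)
  T' : Finset (Fin (4 * p + N % 2) × Fin (4 * p + N % 2))
  request : IsRequestTournament T'
  restrict_eq : T = Finset.univ.filter (fun a => (f a.1, f a.2) ∈ T')

/-- The outcome of a run: the construction on the larger ring, from which the dummy vertices and the
arcs incident with them are removed. -/
def ConstructionRun.family {N : ℕ} {T : Finset (Fin N × Fin N)} (R : ConstructionRun N T) :
    ({b // b ∈ R.S.blocks} × (Fin 4 ⊕ Fin 2)) ⊕ (Fin R.p × Fin 2) → FinDigraph (Fin N) :=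
  fun w => (construction R.S R.T' w).restrict R.f

/-!
The construction is valid because everything reduces to small rings. Whether a dipath of the ring
uses a given ring arc depends only on the cyclic order of three vertices
(`cycleDist_lt_cycleDist_iff`), so the load bound passes to order-preserving copies in larger rings
and to restrictions (`Admissible.copy`, `Admissible.restrict`). The digraphs of a triple `i < j < k`
are such a copy of the partition of `K_{4,4,4}` on 12 vertices, which is checked by enumeration, and
those of a column are contained in a copy of a digraph on 4 or 5 vertices. Between different columns
the shortest paths have the same direction as on the small ring (`ringVertex_short`,
`k444Vertex_short`), so that an arc between two columns is covered exactly once, by the triple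
through these columns (`construction_valid`). Counting triples gives the exact cost.

Steiner triple systems come from Steiner quasigroups, by the constructions of Bose
(`p ≡ 3 mod 6`) and Skolem (`p ≡ 1 mod 6`).

For general `N`, the dummy vertices are inserted half each at two antipodal places, which keeps
shortest paths shortest (`IsRequestTournament.exists_extension`). Whatever way at most 14 dummies
are inserted, deleting them changes the cost by `O(N)`, because a vertex lies in `O(N)` digraphs
(`card_construction_mem_le`).

The lower bound `minADM 2 N ≥ 33 N² / 96 - O(N)` combines two facts. A digraph of load at most 2 with
`V` vertices and `E > 0` arcs from a request tournament satisfies `E + 3 ≤ 2 V`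
(`Admissible.card_add_three_le`). The total load of a request tournament is about `N³ / 8`, and each
digraph carries at most `2 N` of it, so at least about `N² / 16` digraphs have an arc. Summing the
inequality over them gives a cost of at least `(N² / 2 + 3 N² / 16) / 2 = 33 N² / 96`, up to `O(N)`
(`IsValidPartition.le_cost`).
-/

/-! ### Cyclic distance and loads -/

theorem cycleDist_eq {N : ℕ} (u v : Fin N) :
    cycleDist u v = if u.val ≤ v.val then v.val - u.val else v.val + N - u.val := by
  have hu := u.isLt
  have hv := v.isLt
  unfold cycleDist
  split_ifs with h
  · rw [show v.val + (N - u.val) = (v.val - u.val) + N by omega, Nat.add_mod_right,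
      Nat.mod_eq_of_lt (by omega)]
  · rw [Nat.mod_eq_of_lt (by omega)]
    omega

theorem cycleDist_spec {N : ℕ} (u v : Fin N) :
    (u.val ≤ v.val ∧ cycleDist u v + u.val = v.val) ∨
      (v.val < u.val ∧ cycleDist u v + u.val = v.val + N) := by
  have hu := u.isLt
  rw [cycleDist_eq]
  split_ifs <;> omega

theorem cycleDist_lt {N : ℕ} (u v : Fin N) : cycleDist u v < N :=
  Nat.mod_lt _ (by have := u.isLt; omega)

theorem cycleDist_self {N : ℕ} (u : Fin N) : cycleDist u u = 0 := by
  simp [cycleDist_eq]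

theorem cycleDist_add_cycleDist {N : ℕ} {u v : Fin N} (h : u ≠ v) :
    cycleDist u v + cycleDist v u = N := by
  have := Fin.val_ne_of_ne h
  have hu := u.isLt
  have hv := v.isLt
  rw [cycleDist_eq, cycleDist_eq]
  split_ifs <;> omega

theorem cycleDist_injective {N : ℕ} (u : Fin N) : Function.Injective (cycleDist u) := by
  intro v w h
  have hu := u.isLt
  have hv := v.isLt
  have hw := w.isLt
  rw [cycleDist_eq, cycleDist_eq] at h
  apply Fin.ext
  split_ifs at h <;> omega

theorem image_cycleDist {N : ℕ} (u : Fin N) :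
    Finset.univ.image (cycleDist u) = Finset.range N := by
  apply Finset.eq_of_subset_of_card_le
  · intro q hq
    obtain ⟨v, -, rfl⟩ := Finset.mem_image.mp hq
    exact Finset.mem_range.mpr (cycleDist_lt u v)
  · rw [Finset.card_image_of_injective _ (cycleDist_injective u)]
    simp

theorem sum_cycleDist {N : ℕ} (u : Fin N) (g : ℕ → ℕ) :
    ∑ v, g (cycleDist u v) = ∑ q ∈ Finset.range N, g q := by
  rw [← image_cycleDist u, Finset.sum_image (cycleDist_injective u).injOn]

/-- Whether the dipath from `u` to `v` uses the ring arc leaving `e` depends only on the cyclic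
order of `u`, `e`, `v`. -/
theorem cycleDist_lt_cycleDist_iff {N : ℕ} (u e v : Fin N) :
    cycleDist u e < cycleDist u v ↔ (u ≤ e ∧ e < v) ∨ (e < v ∧ v < u) ∨ (v < u ∧ u ≤ e) := by
  have hu := u.isLt
  have hv := v.isLt
  have he := e.isLt
  rw [cycleDist_eq, cycleDist_eq]
  simp only [Fin.lt_def, Fin.le_def]
  split_ifs <;> omega

theorem Admissible.of_subset {N C : ℕ} {B B' : FinDigraph (Fin N)} (h : Admissible C B')
    (hE : B.E ⊆ B'.E) : Admissible C B := fun e =>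
  (Finset.card_le_card (Finset.filter_subset_filter _ hE)).trans (h e)

/-- Placing a digraph on a larger ring, in the same order, does not increase the maximum load:
a ring arc leaving `e` carries the load of the arc leaving the last vertex of the copy before `e`. -/
theorem Admissible.copy {n N C : ℕ} {G : FinDigraph (Fin n)} (hG : Admissible C G)
    {f : Fin n → Fin N} (hf : StrictMono f) : Admissible C (G.copy f) := by
  intro e
  rcases Nat.eq_zero_or_pos n with rfl | hn
  · have : G.E = ∅ := Finset.eq_empty_of_forall_notMem fun a => a.1.elim0
    simp [load, FinDigraph.copy, this]
  obtain ⟨e', he'⟩ : ∃ e' : Fin n, ∀ u v : Fin n,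
      cycleDist (f u) e < cycleDist (f u) (f v) → cycleDist u e' < cycleDist u v := by
    simp only [cycleDist_lt_cycleDist_iff, hf.lt_iff_lt]
    by_cases hex : ∃ u, f u ≤ e
    · obtain ⟨m, hm, hmax⟩ := (Finset.univ.filter fun u => f u ≤ e).exists_max_image id
        (by obtain ⟨u, hu⟩ := hex; exact ⟨u, by simpa using hu⟩)
      have key : ∀ u, f u ≤ e ↔ u ≤ m := fun u =>
        ⟨fun h => hmax u (by simpa using h), fun h =>
          (hf.monotone h).trans (by simpa using hm)⟩
      have key' : ∀ u, e < f u ↔ m < u := fun u => by rw [← not_le, key, not_le]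
      exact ⟨m, fun u v => by rw [key, key']; exact id⟩
    · push Not at hex
      refine ⟨⟨n - 1, by omega⟩, fun u v h => ?_⟩
      have hu : u ≤ (⟨n - 1, by omega⟩ : Fin n) := by rw [Fin.le_def]; simp; omega
      rcases h with h | h | h
      · exact absurd h.1 (not_le.mpr (hex u))
      · exact Or.inr (Or.inr ⟨h.2, hu⟩)
      · exact absurd h.2 (not_le.mpr (hex u))
  refine le_trans ?_ (hG e')
  unfold load FinDigraph.copy
  refine (Finset.card_le_card (t := (G.E.filter fun a => cycleDist a.1 e' < cycleDist a.1 a.2).image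
    fun a => (f a.1, f a.2)) ?_).trans Finset.card_image_le
  intro a ha
  obtain ⟨ha, hlt⟩ := Finset.mem_filter.mp ha
  obtain ⟨c, hc, rfl⟩ := Finset.mem_image.mp ha
  exact Finset.mem_image.mpr ⟨c, Finset.mem_filter.mpr ⟨hc, he' _ _ hlt⟩, rfl⟩

theorem Admissible.restrict {n N C : ℕ} {G : FinDigraph (Fin N)} (hG : Admissible C G)
    {f : Fin n → Fin N} (hf : StrictMono f) : Admissible C (G.restrict f) := by
  intro e
  refine le_trans ?_ (hG (f e))
  unfold load FinDigraph.restrict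
  refine Finset.card_le_card_of_injOn (fun a => (f a.1, f a.2)) ?_ ?_
  · intro a ha
    simp only [Finset.coe_filter, Finset.mem_filter, Finset.mem_univ, true_and,
      Set.mem_ofPred_eq, cycleDist_lt_cycleDist_iff, hf.lt_iff_lt, hf.le_iff_le] at ha ⊢
    exact ha
  · intro a _ b _ h
    simp only [Prod.mk.injEq] at h
    exact Prod.ext (hf.injective h.1) (hf.injective h.2)

/-! ### Request tournaments -/

theorem IsRequestTournament.mem_or_mem {N : ℕ} {T : Finset (Fin N × Fin N)}
    (hT : IsRequestTournament T) {u v : Fin N} (h : u ≠ v) : (u, v) ∈ T ∨ (v, u) ∈ T := by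
  have := cycleDist_add_cycleDist h
  rcases lt_trichotomy (2 * cycleDist u v) N with h1 | h1 | h1
  · exact Or.inl (hT.short u v h h1)
  · exact (hT.antipodal u v h1).or
  · exact Or.inr (hT.short v u h.symm (by omega))

theorem IsRequestTournament.swap_notMem {N : ℕ} {T : Finset (Fin N × Fin N)}
    (hT : IsRequestTournament T) {u v : Fin N} (h : (u, v) ∈ T) : (v, u) ∉ T := by
  intro h'
  have h1 := hT.only u v h
  have h2 := hT.only v u h'
  have := cycleDist_add_cycleDist h1.1
  rcases hT.antipodal u v (by omega) with h3 | h3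
  · exact h3.2 h'
  · exact h3.2 h

/-! ### Steiner triple systems -/

/-- A Steiner quasigroup (a totally symmetric idempotent quasigroup) of order `p` gives a Steiner
triple system: the blocks are the sets `{x, y, x * y}` with `x ≠ y`. -/
theorem SteinerTripleSystem.nonempty_of_quasigroup {p : ℕ} {Q : Type} [Fintype Q]
    (hp : Fintype.card Q = p) (op : Q → Q → Q) (idem : ∀ x, op x x = x)
    (comm : ∀ x y, op x y = op y x) (cancel : ∀ x y, op x (op x y) = y) :
    Nonempty (SteinerTripleSystem p) := by
  classical
  -- transport of the operation to the standard set with `p` elements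
  let φ : Q ≃ Fin p := Fintype.equivFinOfCardEq hp
  obtain ⟨m, idem, comm, cancel⟩ : ∃ m : Fin p → Fin p → Fin p, (∀ x, m x x = x) ∧
      (∀ x y, m x y = m y x) ∧ ∀ x y, m x (m x y) = y :=
    ⟨fun x y => φ (op (φ.symm x) (φ.symm y)), fun x => by simp [idem],
      fun x y => by simp [comm (φ.symm x)], fun x y => by simp [cancel]⟩
  have hne : ∀ x y, x ≠ y → m x y ≠ x := fun x y h h' => h (by
    have := cancel x y
    rw [h', idem] at this
    exact this)
  have hne' : ∀ x y, x ≠ y → m x y ≠ y := fun x y h => comm x y ▸ hne y x h.symm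
  have cancel' : ∀ x y, m y (m x y) = x := fun x y => by rw [comm x y, cancel]
  refine ⟨⟨(Finset.univ.filter fun a : Fin p × Fin p => a.1 ≠ a.2).image
    fun a => {a.1, a.2, m a.1 a.2}, ?_, ?_⟩⟩
  · intro b hb
    simp only [Finset.mem_image, Finset.mem_filter, Finset.mem_univ, true_and] at hb
    obtain ⟨⟨x, y⟩, hxy, rfl⟩ := hb
    exact Finset.card_eq_three.mpr ⟨x, y, m x y, hxy, (hne x y hxy).symm, (hne' x y hxy).symm, rfl⟩
  · intro i j hij
    refine ⟨{i, j, m i j}, ⟨Finset.mem_image.mpr ⟨(i, j), by simpa using hij, rfl⟩, by simp,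
      by simp⟩, ?_⟩
    rintro b ⟨hb, hi, hj⟩
    simp only [Finset.mem_image, Finset.mem_filter, Finset.mem_univ, true_and] at hb
    obtain ⟨⟨x, y⟩, hxy, rfl⟩ := hb
    simp only [Finset.mem_insert, Finset.mem_singleton] at hi hj
    have e1 := cancel x y
    have e2 := cancel' x y
    have e3 := comm x y
    have e4 := comm x (m x y)
    have e5 := comm y (m x y)
    ext z
    simp only [Finset.mem_insert, Finset.mem_singleton]
    rcases hi with rfl | rfl | rfl <;> rcases hj with rfl | rfl | rfl <;>
      first | exact absurd rfl hij | (grind)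

/-- **Bose's construction.** If `m` is an idempotent commutative quasigroup operation on `Q`, with
left division `d`, this is a Steiner quasigroup operation on `Q × ℤ/3`. -/
def boseOp {Q : Type} [DecidableEq Q] (m d : Q → Q → Q) (a b : Q × Fin 3) : Q × Fin 3 :=
  if a.2 = b.2 then (if a.1 = b.1 then a else (m a.1 b.1, a.2 + 1))
  else if b.2 = a.2 + 1 then (if a.1 = b.1 then (a.1, a.2 + 2) else (d a.1 b.1, a.2))
  else (if a.1 = b.1 then (b.1, b.2 + 2) else (d b.1 a.1, b.2))

theorem SteinerTripleSystem.nonempty_bose {p : ℕ} {Q : Type} [Fintype Q] [DecidableEq Q]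
    (hp : 3 * Fintype.card Q = p) (m d : Q → Q → Q) (comm : ∀ x y, m x y = m y x)
    (dm : ∀ x y, d x (m x y) = y) (md : ∀ x y, m x (d x y) = y) (idem : ∀ x, m x x = x) :
    Nonempty (SteinerTripleSystem p) := by
  have hm : ∀ x y, x = m x y → x = y := fun x y h => by
    have h1 := dm x y
    have h2 := dm x x
    rw [idem] at h2
    rw [← h, h2] at h1
    exact h1
  have hd : ∀ x y, x = d x y → x = y := fun x y h => by
    have h1 := md x y
    rw [← h, idem] at h1
    exact h1
  refine nonempty_of_quasigroup (Q := Q × Fin 3) (by simp; omega) (boseOp m d) ?_ ?_ ?_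
  · intro x
    simp [boseOp]
  · rintro ⟨x, i⟩ ⟨y, j⟩
    fin_cases i <;> fin_cases j <;> simp [boseOp] <;> grind
  · rintro ⟨x, i⟩ ⟨y, j⟩
    fin_cases i <;> fin_cases j <;> simp [boseOp] <;> by_cases hxy : x = y <;> simp [hxy] <;> grind

/-- **Skolem's construction.** If `m` is a commutative quasigroup operation on `Q`, with left
division `d`, such that `m x x` is `x` when `low x` holds and `κ x` otherwise, where the involution
`κ` exchanges the low and the other elements, then this is a Steiner quasigroup operation on
`Q × ℤ/3` with one point added. -/
def skolemOp {Q : Type} [DecidableEq Q] (m d : Q → Q → Q) (low : Q → Prop) [DecidablePred low]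
    (κ : Q → Q) : Option (Q × Fin 3) → Option (Q × Fin 3) → Option (Q × Fin 3)
  | none, none => none
  | none, some b => some (κ b.1, if low b.1 then b.2 + 2 else b.2 + 1)
  | some a, none => some (κ a.1, if low a.1 then a.2 + 2 else a.2 + 1)
  | some a, some b =>
    if a.2 = b.2 then (if a.1 = b.1 then some a else some (m a.1 b.1, a.2 + 1))
    else if b.2 = a.2 + 1 then
      (if d a.1 b.1 = a.1 then (if low a.1 then some (a.1, a.2 + 2) else none)
        else some (d a.1 b.1, a.2))
    else
      (if d b.1 a.1 = b.1 then (if low b.1 then some (b.1, b.2 + 2) else none)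
        else some (d b.1 a.1, b.2))

theorem SteinerTripleSystem.nonempty_skolem {p : ℕ} {Q : Type} [Fintype Q] [DecidableEq Q]
    (hp : 3 * Fintype.card Q + 1 = p) (m d : Q → Q → Q) (low : Q → Prop) [DecidablePred low]
    (κ : Q → Q) (comm : ∀ x y, m x y = m y x)
    (dm : ∀ x y, d x (m x y) = y) (md : ∀ x y, m x (d x y) = y)
    (idem : ∀ x, low x → m x x = x) (idem' : ∀ x, ¬ low x → m x x = κ x)
    (hκ : ∀ x, κ (κ x) = x) (hlow : ∀ x, low (κ x) ↔ ¬ low x) :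
    Nonempty (SteinerTripleSystem p) := by
  refine nonempty_of_quasigroup (Q := Option (Q × Fin 3)) (by simp; omega)
    (skolemOp m d low κ) ?_ ?_ ?_
  · rintro (_ | x) <;> simp [skolemOp]
  · rintro (_ | ⟨x, i⟩) (_ | ⟨y, j⟩)
    · rfl
    · rfl
    · rfl
    · fin_cases i <;> fin_cases j <;> simp [skolemOp] <;> grind
  · rintro (_ | ⟨x, i⟩) (_ | ⟨y, j⟩)
    · rfl
    · fin_cases j <;> by_cases h : low y <;> simp [skolemOp, hκ, hlow, h]
    · have hd : ∀ z w, m z w = x → d z x = w := fun z w h => h ▸ dm z w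
      fin_cases i <;> by_cases h : low x <;> simp [skolemOp, h] <;> grind
    · fin_cases i <;> fin_cases j <;> simp only [skolemOp] <;> grind

theorem SteinerTripleSystem.nonempty_of_mod {p : ℕ} (hp : p % 6 = 1 ∨ p % 6 = 3) :
    Nonempty (SteinerTripleSystem p) := by
  rcases hp with hp | hp
  · -- the quasigroup is addition on `ℤ/2k` followed by the relabelling `2 i ↦ i`, `2 i + 1 ↦ i + k`
    obtain ⟨k, rfl⟩ : ∃ k, p = 6 * k + 1 := ⟨p / 6, by omega⟩
    refine nonempty_skolem (Q := Fin (2 * k)) (by simp; omega)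
      (fun x y =>
        let s := if x.val + y.val < 2 * k then x.val + y.val else x.val + y.val - 2 * k
        ⟨if s % 2 = 0 then s / 2 else s / 2 + k, by grind⟩)
      (fun x y =>
        let s := if y.val < k then 2 * y.val else 2 * (y.val - k) + 1
        ⟨if x.val ≤ s then s - x.val else s + 2 * k - x.val, by grind⟩)
      (fun x => x.val < k)
      (fun x => ⟨if x.val < k then x.val + k else x.val - k, by grind⟩)
      ?_ ?_ ?_ ?_ ?_ ?_ ?_
    · intro x y
      simp only [Nat.add_comm]
    · intro x y
      apply Fin.ext
      grind
    · intro x y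
      apply Fin.ext
      grind
    · intro x h
      apply Fin.ext
      grind
    · intro x h
      apply Fin.ext
      grind
    · intro x
      apply Fin.ext
      grind
    · intro x
      grind
  · -- the quasigroup is `x ∘ y = (x + y) / 2` on `ℤ/(2k + 1)`
    obtain ⟨k, rfl⟩ : ∃ k, p = 6 * k + 3 := ⟨p / 6, by omega⟩
    have h2 : (2 : ZMod (2 * k + 1)) * ((k + 1 : ℕ) : ZMod (2 * k + 1)) = 1 := by
      have : ((2 * k + 1 : ℕ) : ZMod (2 * k + 1)) = 0 := ZMod.natCast_self _
      push_cast at this ⊢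
      linear_combination this
    refine nonempty_bose (Q := ZMod (2 * k + 1)) (by simp [ZMod.card]; omega)
      (fun x y => ((k + 1 : ℕ) : ZMod (2 * k + 1)) * (x + y)) (fun x y => 2 * y - x) ?_ ?_ ?_ ?_
    · intro x y
      ring
    · intro x y
      linear_combination (x + y) * h2
    · intro x y
      linear_combination y * h2
    · intro x
      linear_combination x * h2

/-! ### The partition of the oriented `K_{4,4,4}` -/

theorem k444_admissible (m : Fin 4 ⊕ Fin 2) : Admissible 2 (k444Family k444Vertex m) := by
  unfold Admissible
  revert m
  decide +kernel

theorem k444_subset (m : Fin 4 ⊕ Fin 2) : (k444Family k444Vertex m).E ⊆ k444Arcs := by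
  revert m
  decide +kernel

/-- The six digraphs partition the arcs of the oriented `K_{4,4,4}`, with uniqueness spelled out so
that the statement is decidable by enumeration. -/
theorem k444_cover : ∀ a ∈ k444Arcs, ∃ m, a ∈ (k444Family k444Vertex m).E ∧
    ∀ m', a ∈ (k444Family k444Vertex m').E → m' = m := by
  decide +kernel

theorem k444_card : ∑ m, (k444Family k444Vertex m).V.card = 34 := by
  decide +kernel

/-! ### The vertices of the ring and their columns -/

theorem FinDigraph.mem_copy_E {α β : Type*} [DecidableEq α] [DecidableEq β] {G : FinDigraph α}
    {f : α → β} {u v : β} : (u, v) ∈ (G.copy f).E ↔ ∃ a b, (a, b) ∈ G.E ∧ f a = u ∧ f b = v := by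
  simp [FinDigraph.copy]

theorem ringVertex_inj {p t : ℕ} {L L' : Fin 4} {i i' : Fin p} :
    ringVertex p t L i = ringVertex p t L' i' ↔ L = L' ∧ i = i' := by
  refine ⟨fun h => ?_, fun h => by rw [h.1, h.2]⟩
  have h := congrArg Fin.val h
  simp only [ringVertex] at h
  have hi := i.isLt
  have hi' := i'.isLt
  have hL : L = L' := by
    rcases lt_trichotomy L.val L'.val with hl | hl | hl
    · have := Nat.mul_le_mul_right p (Nat.succ_le_of_lt hl)
      rw [Nat.succ_mul] at this
      omega
    · exact Fin.ext hl
    · have := Nat.mul_le_mul_right p (Nat.succ_le_of_lt hl)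
      rw [Nat.succ_mul] at this
      omega
  subst hL
  exact ⟨rfl, Fin.ext (by omega)⟩

theorem exists_eq_ringVertex {p t : ℕ} (x : Fin (4 * p + t)) (h : x.val < 4 * p) :
    ∃ L i, x = ringVertex p t L i :=
  ⟨⟨x.val / p, Nat.div_lt_of_lt_mul (by omega)⟩, ⟨x.val % p, Nat.mod_lt _ (by omega)⟩,
    Fin.ext (Nat.div_add_mod' x.val p).symm⟩

theorem ringVertex_val_lt {p t : ℕ} (L : Fin 4) (i : Fin p) :
    (ringVertex p t L i).val < 4 * p := by
  have h := i.isLt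
  have hL : L.val * p ≤ 3 * p := Nat.mul_le_mul_right p (by omega)
  simp only [ringVertex]
  omega

theorem mem_column {p t : ℕ} {i : Fin p} {x : Fin (4 * p + t)} :
    x ∈ column p t i ↔ (∃ L, ringVertex p t L i = x) ∨ 4 * p ≤ x.val := by
  simp [column, extraVertices]

theorem mem_smallColumn {p t : ℕ} {i : Fin p} {x : Fin (4 * p + t)} :
    x ∈ smallColumn p t i ↔
      (x = ringVertex p t 1 i ∨ x = ringVertex p t 3 i) ∨ 4 * p ≤ x.val := by
  simp only [smallColumn, extraVertices, Finset.mem_union, Finset.mem_insert,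
    Finset.mem_singleton, Finset.mem_filter, Finset.mem_univ, true_and]

theorem ringVertex_mem_column {p t : ℕ} {L : Fin 4} {i j : Fin p} :
    ringVertex p t L i ∈ column p t j ↔ i = j := by
  rw [mem_column]
  constructor
  · rintro (⟨L', h⟩ | h)
    · exact (ringVertex_inj.mp h).2.symm
    · exact absurd h (not_le.mpr (ringVertex_val_lt L i))
  · rintro rfl
    exact Or.inl ⟨L, rfl⟩

theorem smallColumn_subset_column {p t : ℕ} (i : Fin p) : smallColumn p t i ⊆ column p t i := by
  intro x
  rw [mem_smallColumn, mem_column]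
  rintro ((rfl | rfl) | h)
  · exact Or.inl ⟨1, rfl⟩
  · exact Or.inl ⟨3, rfl⟩
  · exact Or.inr h

/-! ### The digraphs of a triple -/

theorem k444Family_copy {α β : Type*} [DecidableEq α] [DecidableEq β] (v : Fin 4 → Fin 3 → α)
    (f : α → β) (m : Fin 4 ⊕ Fin 2) :
    (k444Family v m).copy f = k444Family (fun L c => f (v L c)) m := by
  rcases m with m | m <;>
    simp [k444Family, FinDigraph.copy, Finset.image_image, Function.comp_def]

/-- The order-preserving inclusion of the ring with 12 vertices that sends the classes of the
`K_{4,4,4}` to the columns of `x 0`, `x 1`, `x 2`. -/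
def blockVertex (p t : ℕ) (x : Fin 3 → Fin p) (z : Fin 12) : Fin (4 * p + t) :=
  ringVertex p t ⟨z.val / 3, by omega⟩ (x ⟨z.val % 3, by omega⟩)

theorem blockVertex_k444Vertex {p t : ℕ} (x : Fin 3 → Fin p) (L : Fin 4) (c : Fin 3) :
    blockVertex p t x (k444Vertex L c) = ringVertex p t L (x c) := by
  have h1 : (⟨(k444Vertex L c).val / 3, by omega⟩ : Fin 4) = L :=
    Fin.ext (by simp only [k444Vertex]; omega)
  have h2 : (⟨(k444Vertex L c).val % 3, by omega⟩ : Fin 3) = c :=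
    Fin.ext (by simp only [k444Vertex]; omega)
  rw [blockVertex, h1, h2]

theorem blockVertex_strictMono {p t : ℕ} {x : Fin 3 → Fin p} (hx : StrictMono x) :
    StrictMono (blockVertex p t x) := by
  intro z w hzw
  rw [Fin.lt_def] at hzw ⊢
  simp only [blockVertex, ringVertex]
  have h1 := (x ⟨z.val % 3, by omega⟩).isLt
  rcases Nat.lt_or_ge (z.val / 3) (w.val / 3) with h | h
  · have := Nat.mul_le_mul_right p (Nat.succ_le_of_lt h)
    rw [Nat.succ_mul] at this
    omega
  · have h2 : z.val / 3 = w.val / 3 := by omega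
    have h3 : x ⟨z.val % 3, by omega⟩ < x ⟨w.val % 3, by omega⟩ :=
      hx (by rw [Fin.lt_def]; simp only; omega)
    rw [Fin.lt_def] at h3
    rw [h2]
    omega

theorem exists_eq_k444Vertex (z : Fin 12) : ∃ L c, z = k444Vertex L c :=
  ⟨⟨z.val / 3, by omega⟩, ⟨z.val % 3, by omega⟩, Fin.ext (by simp only [k444Vertex]; omega)⟩

theorem k444Vertex_mem_arcs {L L' : Fin 4} {c c' : Fin 3} :
    (k444Vertex L c, k444Vertex L' c') ∈ k444Arcs ↔
      c ≠ c' ∧ 2 * cycleDist (k444Vertex L c) (k444Vertex L' c') < 12 := by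
  have h : (k444Vertex L c).val % 3 = c.val := by simp only [k444Vertex]; omega
  have h' : (k444Vertex L' c').val % 3 = c'.val := by simp only [k444Vertex]; omega
  simp only [k444Arcs, Finset.mem_filter, Finset.mem_univ, true_and, h, h', ne_eq, Fin.ext_iff]

/-- Between vertices in different columns, the shortest path on the large ring goes in the same
direction as on the ring with 12 vertices. -/
theorem ringVertex_short {p t : ℕ} (ht : t < 2) (L L' : Fin 4) {i j : Fin p} {c c' : Fin 3}
    (h : c < c' ∧ i < j ∨ c' < c ∧ j < i)
    (hd : 2 * cycleDist (k444Vertex L c) (k444Vertex L' c') < 12) :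
    2 * cycleDist (ringVertex p t L i) (ringVertex p t L' j) < 4 * p + t := by
  have hi := i.isLt
  have hj := j.isLt
  have hc := c.isLt
  have hc' := c'.isLt
  simp only [Fin.lt_def] at h
  have h1 := cycleDist_spec (ringVertex p t L i) (ringVertex p t L' j)
  have h2 := cycleDist_spec (k444Vertex L c) (k444Vertex L' c')
  generalize cycleDist (ringVertex p t L i) (ringVertex p t L' j) = d1 at *
  generalize cycleDist (k444Vertex L c) (k444Vertex L' c') = d2 at *
  simp only [ringVertex, k444Vertex] at h1 h2
  fin_cases L <;> fin_cases L' <;> simp at h1 h2 <;> omega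

theorem k444Vertex_short {p t : ℕ} (ht : t < 2) (L L' : Fin 4) {i j : Fin p} {c c' : Fin 3}
    (h : c < c' ∧ i < j ∨ c' < c ∧ j < i)
    (hd : 2 * cycleDist (ringVertex p t L i) (ringVertex p t L' j) ≤ 4 * p + t) :
    2 * cycleDist (k444Vertex L c) (k444Vertex L' c') < 12 := by
  have hi := i.isLt
  have hj := j.isLt
  have hc := c.isLt
  have hc' := c'.isLt
  simp only [Fin.lt_def] at h
  have h1 := cycleDist_spec (ringVertex p t L i) (ringVertex p t L' j)
  have h2 := cycleDist_spec (k444Vertex L c) (k444Vertex L' c')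
  generalize cycleDist (ringVertex p t L i) (ringVertex p t L' j) = d1 at *
  generalize cycleDist (k444Vertex L c) (k444Vertex L' c') = d2 at *
  simp only [ringVertex, k444Vertex] at h1 h2
  fin_cases L <;> fin_cases L' <;> simp at h1 h2 <;> omega

/-! ### The digraphs of a column -/

/-- The order-preserving inclusion of the ring with `4 + t` vertices onto the column of `i`. -/
def columnVertex (p t : ℕ) (i : Fin p) (z : Fin (4 + t)) : Fin (4 * p + t) :=
  if h : z.val < 4 then ringVertex p t ⟨z.val, h⟩ i else ⟨4 * p + (z.val - 4), by omega⟩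

theorem columnVertex_strictMono {p t : ℕ} (i : Fin p) : StrictMono (columnVertex p t i) := by
  intro z w hzw
  rw [Fin.lt_def] at hzw ⊢
  unfold columnVertex
  have hi := i.isLt
  split_ifs with hz hw hw
  · simp only [ringVertex]
    have := Nat.mul_lt_mul_of_pos_right hzw (show 0 < p by omega)
    omega
  · have := ringVertex_val_lt (t := t) ⟨z.val, hz⟩ i
    simp only
    omega
  · omega
  · simp only
    omega

theorem image_columnVertex {p t : ℕ} (i : Fin p) :
    Finset.univ.image (columnVertex p t i) = column p t i := by
  ext x
  rw [mem_column, Finset.mem_image]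
  constructor
  · rintro ⟨z, -, rfl⟩
    unfold columnVertex
    split_ifs with h
    · exact Or.inl ⟨_, rfl⟩
    · exact Or.inr (by simp)
  · rintro (⟨L, rfl⟩ | h)
    · exact ⟨⟨L.val, by omega⟩, Finset.mem_univ _, by simp [columnVertex]⟩
    · exact ⟨⟨4 + (x.val - 4 * p), by omega⟩, Finset.mem_univ _,
        Fin.ext (by simp [columnVertex]; omega)⟩

theorem columnVertex_mem_smallColumn {p t : ℕ} (i : Fin p) (z : Fin (4 + t)) :
    columnVertex p t i z ∈ smallColumn p t i ↔ z.val = 1 ∨ z.val = 3 ∨ 4 ≤ z.val := by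
  rw [mem_smallColumn]
  unfold columnVertex
  split_ifs with h
  · have := ringVertex_val_lt (t := t) ⟨z.val, h⟩ i
    have h1 : (⟨z.val, h⟩ : Fin 4) = 1 ↔ z.val = 1 := Fin.ext_iff
    have h3 : (⟨z.val, h⟩ : Fin 4) = 3 ↔ z.val = 3 := Fin.ext_iff
    rw [ringVertex_inj, ringVertex_inj, h1, h3]
    omega
  · simp
    omega

theorem columnVertex_dist {p t : ℕ} (ht : t < 2) (i : Fin p) (z w : Fin (4 + t))
    (h : 2 * cycleDist (columnVertex p t i z) (columnVertex p t i w) ≤ 4 * p + t) :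
    2 * cycleDist z w ≤ 4 + t := by
  have hi := i.isLt
  have h1 := cycleDist_spec (columnVertex p t i z) (columnVertex p t i w)
  have h2 := cycleDist_spec z w
  generalize cycleDist (columnVertex p t i z) (columnVertex p t i w) = d1 at *
  generalize cycleDist z w = d2 at *
  interval_cases t <;> fin_cases z <;> fin_cases w <;>
    simp [columnVertex, ringVertex] at h1 h2 ⊢ <;> omega

/-- The model of the column digraphs on the ring with `4 + t` vertices: all the arcs along shortest
paths (both of them for an antipodal pair) that lie inside (`s = 1`) or do not lie inside (`s = 0`)
the set formed by `1`, `3` and the vertices from `4` on. -/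
def columnModel (t : ℕ) (s : Fin 2) : FinDigraph (Fin (4 + t)) where
  V := Finset.univ
  E := Finset.univ.filter fun a => (a.1 ≠ a.2 ∧ 2 * cycleDist a.1 a.2 ≤ 4 + t) ∧
    (((a.1.val = 1 ∨ a.1.val = 3 ∨ 4 ≤ a.1.val) ∧ (a.2.val = 1 ∨ a.2.val = 3 ∨ 4 ≤ a.2.val)) ↔
      s = 1)
  endpoints := by simp

theorem columnModel_admissible {t : ℕ} (ht : t < 2) (s : Fin 2) :
    Admissible 2 (columnModel t s) := by
  unfold Admissible
  revert s
  interval_cases t <;> decide +kernel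

theorem columnFamily_mem {p t : ℕ} {T : Finset (Fin (4 * p + t) × Fin (4 * p + t))} {i : Fin p}
    {m : Fin 2} {a : Fin (4 * p + t) × Fin (4 * p + t)} :
    a ∈ (columnFamily T i m).E ↔ a ∈ T ∧ (a.1 ∈ column p t i ∧ a.2 ∈ column p t i) ∧
      ((a.1 ∈ smallColumn p t i ∧ a.2 ∈ smallColumn p t i) ↔ m = 1) := by
  have := @smallColumn_subset_column p t i a.1
  have := @smallColumn_subset_column p t i a.2
  fin_cases m
  · simp [columnFamily]
  · simp [columnFamily]
    tauto

theorem columnFamily_admissible {p t : ℕ} (ht : t < 2)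
    {T : Finset (Fin (4 * p + t) × Fin (4 * p + t))} (hT : IsRequestTournament T) (i : Fin p)
    (m : Fin 2) : Admissible 2 (columnFamily T i m) := by
  refine ((columnModel_admissible ht m).copy (columnVertex_strictMono (p := p) i)).of_subset ?_
  rintro ⟨u, v⟩ h
  obtain ⟨hT', ⟨hu, hv⟩, hm⟩ := columnFamily_mem.mp h
  simp only [← image_columnVertex, Finset.mem_image, Finset.mem_univ, true_and] at hu hv
  obtain ⟨z, rfl⟩ := hu
  obtain ⟨w, rfl⟩ := hv
  simp only [columnVertex_mem_smallColumn] at hm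
  have h2 := hT.only _ _ hT'
  exact FinDigraph.mem_copy_E.mpr ⟨z, w, Finset.mem_filter.mpr ⟨Finset.mem_univ _,
    ⟨fun hzw => h2.1 (by rw [show z = w from hzw]), columnVertex_dist ht i z w h2.2⟩, hm⟩, rfl, rfl⟩

theorem sum_columnFamily_card {p t : ℕ} (ht : t < 2)
    (T : Finset (Fin (4 * p + t) × Fin (4 * p + t))) (i : Fin p) :
    ∑ m, (columnFamily T i m).V.card = 6 + 2 * t := by
  have h1 : (column p t i).card = 4 + t := by
    rw [← image_columnVertex, Finset.card_image_of_injective _ (columnVertex_strictMono i).injective,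
      Finset.card_univ, Fintype.card_fin]
  have h2 : (smallColumn p t i).card = 2 + t := by
    have : smallColumn p t i = (Finset.univ.filter fun z : Fin (4 + t) =>
        z.val = 1 ∨ z.val = 3 ∨ 4 ≤ z.val).image (columnVertex p t i) := by
      ext x
      simp only [Finset.mem_image, Finset.mem_filter, Finset.mem_univ, true_and,
        ← columnVertex_mem_smallColumn i]
      constructor
      · intro hx
        have hx' := smallColumn_subset_column i hx
        rw [← image_columnVertex, Finset.mem_image] at hx'
        obtain ⟨z, -, rfl⟩ := hx'
        exact ⟨z, hx, rfl⟩
      · rintro ⟨z, hz, rfl⟩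
        exact hz
    rw [this, Finset.card_image_of_injective _ (columnVertex_strictMono i).injective]
    interval_cases t <;> decide
  rw [Fin.sum_univ_two]
  change (column p t i).card + (smallColumn p t i).card = _
  omega

/-! ### The construction on `4 p + t` vertices -/

/-- The increasing enumeration of a triple of the Steiner triple system. -/
def SteinerTripleSystem.enum {p : ℕ} (S : SteinerTripleSystem p) (b : {b // b ∈ S.blocks}) :
    Fin 3 ↪o Fin p :=
  b.1.orderEmbOfFin (S.card_eq b.1 b.2)

theorem SteinerTripleSystem.enum_mem {p : ℕ} (S : SteinerTripleSystem p)
    (b : {b // b ∈ S.blocks}) (c : Fin 3) : S.enum b c ∈ b.1 :=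
  Finset.orderEmbOfFin_mem _ _ c

theorem SteinerTripleSystem.exists_enum {p : ℕ} (S : SteinerTripleSystem p)
    (b : {b // b ∈ S.blocks}) {i : Fin p} (hi : i ∈ b.1) : ∃ c, S.enum b c = i := by
  have := Finset.range_orderEmbOfFin b.1 (S.card_eq b.1 b.2)
  exact (Set.ext_iff.mp this i).mpr hi

theorem construction_inl {p t : ℕ} (S : SteinerTripleSystem p)
    (T : Finset (Fin (4 * p + t) × Fin (4 * p + t))) (b : {b // b ∈ S.blocks})
    (m : Fin 4 ⊕ Fin 2) : construction S T (Sum.inl (b, m)) =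
      (k444Family k444Vertex m).copy (blockVertex p t (S.enum b)) := by
  rw [k444Family_copy]
  simp only [blockVertex_k444Vertex]
  rfl

theorem mem_construction_inl {p t : ℕ} {S : SteinerTripleSystem p}
    {T : Finset (Fin (4 * p + t) × Fin (4 * p + t))} {b : {b // b ∈ S.blocks}}
    {m : Fin 4 ⊕ Fin 2} {u v : Fin (4 * p + t)} :
    (u, v) ∈ (construction S T (Sum.inl (b, m))).E ↔
      ∃ L c L' c', (k444Vertex L c, k444Vertex L' c') ∈ (k444Family k444Vertex m).E ∧
        ringVertex p t L (S.enum b c) = u ∧ ringVertex p t L' (S.enum b c') = v := by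
  rw [construction_inl, FinDigraph.mem_copy_E]
  constructor
  · rintro ⟨z, w, h, rfl, rfl⟩
    obtain ⟨L, c, rfl⟩ := exists_eq_k444Vertex z
    obtain ⟨L', c', rfl⟩ := exists_eq_k444Vertex w
    exact ⟨L, c, L', c', h, (blockVertex_k444Vertex _ _ _).symm,
      (blockVertex_k444Vertex _ _ _).symm⟩
  · rintro ⟨L, c, L', c', h, rfl, rfl⟩
    exact ⟨_, _, h, blockVertex_k444Vertex _ _ _, blockVertex_k444Vertex _ _ _⟩

theorem construction_valid {p t : ℕ} (ht : t < 2) (S : SteinerTripleSystem p)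
    {T : Finset (Fin (4 * p + t) × Fin (4 * p + t))} (hT : IsRequestTournament T) :
    IsValidPartition 2 T (construction S T) := by
  have hlt : ∀ b {c c' : Fin 3}, c ≠ c' →
      c < c' ∧ S.enum b c < S.enum b c' ∨ c' < c ∧ S.enum b c' < S.enum b c := fun b c c' h => by
    simp only [(S.enum b).lt_iff_lt, and_self]
    exact lt_or_gt_of_ne h
  refine ⟨?_, ?_, ?_⟩
  · rintro (⟨b, m⟩ | ⟨i, m⟩)
    · rw [construction_inl]
      exact (k444_admissible m).copy (blockVertex_strictMono (S.enum b).strictMono)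
    · exact columnFamily_admissible ht hT i m
  · rintro (⟨b, m⟩ | ⟨i, m⟩) ⟨u, v⟩ h
    · obtain ⟨L, c, L', c', hE, rfl, rfl⟩ := mem_construction_inl.mp h
      obtain ⟨hc, hd⟩ := k444Vertex_mem_arcs.mp (k444_subset m hE)
      refine hT.short _ _ (fun h => hc ?_) (ringVertex_short ht L L' (hlt b hc) hd)
      exact (S.enum b).injective (ringVertex_inj.mp h).2
    · exact (columnFamily_mem.mp h).1
  · rintro ⟨u, v⟩ ha
    obtain ⟨huv, hd⟩ := hT.only u v ha
    by_cases h1 : ∃ L i L' j, u = ringVertex p t L i ∧ v = ringVertex p t L' j ∧ i ≠ j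
    · -- the two vertices lie in different columns: the arc belongs to the triple of the columns
      obtain ⟨L, i, L', j, rfl, rfl, hij⟩ := h1
      obtain ⟨b, ⟨hb, hib, hjb⟩, hbu⟩ := S.unique i j hij
      obtain ⟨c, hc⟩ := S.exists_enum ⟨b, hb⟩ hib
      obtain ⟨c', hc'⟩ := S.exists_enum ⟨b, hb⟩ hjb
      have hcc : c ≠ c' := fun h => hij (by rw [← hc, ← hc', h])
      have hcc' := hlt ⟨b, hb⟩ hcc
      rw [hc, hc'] at hcc'
      obtain ⟨m, hm, hmu⟩ := k444_cover _
        (k444Vertex_mem_arcs.mpr ⟨hcc, k444Vertex_short ht L L' hcc' hd⟩)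
      refine ⟨Sum.inl (⟨b, hb⟩, m), mem_construction_inl.mpr
        ⟨L, c, L', c', hm, by rw [hc], by rw [hc']⟩, ?_⟩
      rintro (⟨b', m'⟩ | ⟨k, m'⟩) hw
      · obtain ⟨L₁, c₁, L₁', c₁', hE, e, e'⟩ := mem_construction_inl.mp hw
        obtain ⟨rfl, h1⟩ := ringVertex_inj.mp e
        obtain ⟨rfl, h1'⟩ := ringVertex_inj.mp e'
        obtain rfl : b' = ⟨b, hb⟩ := Subtype.ext (hbu _
          ⟨b'.2, h1 ▸ S.enum_mem b' c₁, h1' ▸ S.enum_mem b' c₁'⟩)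
        obtain rfl := (S.enum ⟨b, hb⟩).injective (h1.trans hc.symm)
        obtain rfl := (S.enum ⟨b, hb⟩).injective (h1'.trans hc'.symm)
        rw [hmu m' hE]
      · obtain ⟨-, ⟨hu, hv⟩, -⟩ := columnFamily_mem.mp hw
        rw [ringVertex_mem_column] at hu hv
        exact absurd (hu.trans hv.symm) hij
    · -- otherwise the arc lies inside a single column
      obtain ⟨i, hu, hv, hi⟩ : ∃ i, u ∈ column p t i ∧ v ∈ column p t i ∧
          ∀ k, u ∈ column p t k → v ∈ column p t k → k = i := by
        rcases Nat.lt_or_ge u.val (4 * p) with hu | hu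
        · obtain ⟨L, i, rfl⟩ := exists_eq_ringVertex u hu
          refine ⟨i, ringVertex_mem_column.mpr rfl, ?_, fun k hk _ =>
            (ringVertex_mem_column.mp hk).symm⟩
          rcases Nat.lt_or_ge v.val (4 * p) with hv | hv
          · obtain ⟨L', j, rfl⟩ := exists_eq_ringVertex v hv
            by_contra hj
            rw [ringVertex_mem_column] at hj
            exact h1 ⟨L, i, L', j, rfl, rfl, fun h => hj h.symm⟩
          · exact mem_column.mpr (Or.inr hv)
        · rcases Nat.lt_or_ge v.val (4 * p) with hv | hv
          · obtain ⟨L, i, rfl⟩ := exists_eq_ringVertex v hv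
            exact ⟨i, mem_column.mpr (Or.inr hu), ringVertex_mem_column.mpr rfl, fun k _ hk =>
              (ringVertex_mem_column.mp hk).symm⟩
          · exact absurd (Fin.ext (by omega)) huv
      obtain ⟨m, hm, hmu⟩ : ∃ m : Fin 2, ((u ∈ smallColumn p t i ∧ v ∈ smallColumn p t i) ↔ m = 1) ∧
          ∀ m' : Fin 2, ((u ∈ smallColumn p t i ∧ v ∈ smallColumn p t i) ↔ m' = 1) → m' = m := by
        by_cases hs : u ∈ smallColumn p t i ∧ v ∈ smallColumn p t i
        · exact ⟨1, by simp [hs], fun m' h => h.mp hs⟩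
        · exact ⟨0, by simp [hs], fun m' h => by
            have := h.not.mp hs
            omega⟩
      refine ⟨Sum.inr (i, m), columnFamily_mem.mpr ⟨ha, ⟨hu, hv⟩, hm⟩, ?_⟩
      rintro (⟨b', m'⟩ | ⟨k, m'⟩) hw
      · obtain ⟨L, c, L', c', hE, rfl, rfl⟩ := mem_construction_inl.mp hw
        obtain ⟨hc, -⟩ := k444Vertex_mem_arcs.mp (k444_subset m' hE)
        exact absurd ⟨L, _, L', _, rfl, rfl, fun h => hc ((S.enum b').injective h)⟩ h1
      · obtain ⟨-, ⟨hu', hv'⟩, hm'⟩ := columnFamily_mem.mp hw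
        obtain rfl := hi k hu' hv'
        rw [hmu m' hm']

/-! ### The cost of the construction -/

theorem SteinerTripleSystem.six_mul_card_blocks {p : ℕ} (S : SteinerTripleSystem p) :
    6 * S.blocks.card + p = p * p := by
  have h1 : (Finset.univ : Finset (Fin p)).offDiag = S.blocks.biUnion Finset.offDiag := by
    ext ⟨i, j⟩
    simp only [Finset.mem_offDiag, Finset.mem_univ, true_and, Finset.mem_biUnion]
    constructor
    · intro h
      obtain ⟨b, ⟨hb, hi, hj⟩, -⟩ := S.unique i j h
      exact ⟨b, hb, hi, hj, h⟩
    · rintro ⟨b, -, -, -, h⟩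
      exact h
  have h2 := congrArg Finset.card h1
  rw [Finset.card_biUnion, Finset.sum_congr rfl (g := fun _ => 6), Finset.sum_const,
    Finset.offDiag_card, Finset.card_univ, Fintype.card_fin, smul_eq_mul] at h2
  · have : p ≤ p * p := Nat.le_mul_self p
    omega
  · intro b hb
    rw [Finset.offDiag_card, S.card_eq b hb]
  · intro b hb b' hb' hne
    rw [Function.onFun, Finset.disjoint_left]
    rintro ⟨i, j⟩ h h'
    simp only [Finset.mem_offDiag] at h h'
    exact hne ((S.unique i j h.2.2).unique ⟨hb, h.1, h.2.1⟩ ⟨hb', h'.1, h'.2.1⟩)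

theorem FinDigraph.card_copy_V {α β : Type*} [DecidableEq α] [DecidableEq β] (G : FinDigraph α)
    {f : α → β} (hf : Function.Injective f) : (G.copy f).V.card = G.V.card :=
  Finset.card_image_of_injective _ hf

theorem cost_construction {p t : ℕ} (ht : t < 2) (S : SteinerTripleSystem p)
    (T : Finset (Fin (4 * p + t) × Fin (4 * p + t))) :
    cost (construction S T) = 34 * S.blocks.card + p * (6 + 2 * t) := by
  unfold cost
  rw [Fintype.sum_sum_type, Fintype.sum_prod_type, Fintype.sum_prod_type]
  congr 1
  · rw [Finset.sum_congr rfl (g := fun _ => 34)]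
    · simp [mul_comm]
    · intro b _
      rw [← k444_card]
      refine Finset.sum_congr rfl fun m _ => ?_
      rw [construction_inl]
      exact FinDigraph.card_copy_V _ (blockVertex_strictMono (S.enum b).strictMono).injective
  · rw [Finset.sum_congr rfl (g := fun _ => 6 + 2 * t)]
    · simp
    · intro i _
      exact sum_columnFamily_card ht T i

theorem six_mul_cost_construction {p t : ℕ} (ht : t < 2) (S : SteinerTripleSystem p)
    (T : Finset (Fin (4 * p + t) × Fin (4 * p + t))) :
    6 * (cost (construction S T) : ℝ) = 34 * (p : ℝ) ^ 2 + (2 + 12 * t) * p := by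
  rw [cost_construction ht S T]
  have h : 6 * (S.blocks.card : ℝ) + p = p * p := by exact_mod_cast S.six_mul_card_blocks
  push_cast
  linear_combination 34 * h

/-! ### Insertion of dummy vertices -/

/-- Inserting `d` dummy vertices after the vertex `N / 2 - 1` and `d` dummy vertices after the
vertex `N - 1` turns a request tournament into part of a request tournament on `N + 2 d` vertices:
a dipath of length at most `N / 2` meets at most one of the two places, and a dipath of length
exactly `N / 2` (`N` even) meets exactly one. -/
theorem IsRequestTournament.exists_extension {N M d : ℕ} (hM : N + 2 * d = M)
    {T : Finset (Fin N × Fin N)} (hT : IsRequestTournament T) :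
    ∃ (f : Fin N ↪o Fin M) (T' : Finset (Fin M × Fin M)), IsRequestTournament T' ∧
      T = Finset.univ.filter (fun a => (f a.1, f a.2) ∈ T') := by
  classical
  let g : Fin N → Fin M := fun i =>
    ⟨if i.val < N / 2 then i.val else i.val + d, by have := i.isLt; split_ifs <;> omega⟩
  have hg : ∀ i, (g i).val = if i.val < N / 2 then i.val else i.val + d := fun i => rfl
  have hmono : StrictMono g := by
    intro i j hij
    rw [Fin.lt_def] at hij ⊢
    rw [hg, hg]
    split_ifs <;> omega
  clear_value g
  have hlt : ∀ u v, 2 * cycleDist (g u) (g v) < M ↔ 2 * cycleDist u v < N := by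
    intro u v
    have h1 := cycleDist_spec u v
    have h2 := cycleDist_spec (g u) (g v)
    rw [hg, hg] at h2
    have hu := u.isLt
    have hv := v.isLt
    split_ifs at h2 <;> omega
  have heq : ∀ u v, 2 * cycleDist (g u) (g v) = M ↔ 2 * cycleDist u v = N := by
    intro u v
    have h1 := cycleDist_spec u v
    have h2 := cycleDist_spec (g u) (g v)
    rw [hg, hg] at h2
    have hu := u.isLt
    have hv := v.isLt
    split_ifs at h2 <;> omega
  -- the choice for an antipodal pair is that of `T` for original vertices, and arbitrary otherwise
  let P : Fin M → Fin M → Prop := fun u v =>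
    if ∃ x y, g x = u ∧ g y = v then ∃ x y, (x, y) ∈ T ∧ g x = u ∧ g y = v else u < v
  have hP : ∀ x y, P (g x) (g y) ↔ (x, y) ∈ T := by
    intro x y
    have : ∃ x' y', g x' = g x ∧ g y' = g y := ⟨x, y, rfl, rfl⟩
    simp only [P, this, if_true]
    constructor
    · rintro ⟨x', y', h, h1, h2⟩
      rwa [hmono.injective h1, hmono.injective h2] at h
    · exact fun h => ⟨x, y, h, rfl, rfl⟩
  have hP' : ∀ u v, (¬ ∃ x y, g x = u ∧ g y = v) → (P u v ↔ u < v) := by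
    intro u v h
    simp only [P, h, if_false]
  refine ⟨OrderEmbedding.ofStrictMono g hmono, Finset.univ.filter fun a => a.1 ≠ a.2 ∧
    (2 * cycleDist a.1 a.2 < M ∨ 2 * cycleDist a.1 a.2 = M ∧ P a.1 a.2), ⟨?_, ?_, ?_⟩, ?_⟩
  · intro u v h1 h2
    simp only [Finset.mem_filter, Finset.mem_univ, true_and]
    exact ⟨h1, Or.inl h2⟩
  · intro u v h
    have huv : u ≠ v := by
      rintro rfl
      have := u.isLt
      rw [cycleDist_self] at h
      omega
    have hvu : 2 * cycleDist v u = M := by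
      have := cycleDist_add_cycleDist huv
      omega
    simp only [Finset.mem_filter, Finset.mem_univ, true_and, ne_eq, huv, huv.symm,
      not_false_eq_true, h, hvu, lt_irrefl, false_or]
    by_cases hr : ∃ x y, g x = u ∧ g y = v
    · obtain ⟨x, y, rfl, rfl⟩ := hr
      rw [hP, hP]
      exact hT.antipodal x y ((heq x y).mp h)
    · have hr' : ¬ ∃ x y, g x = v ∧ g y = u := fun ⟨x, y, h1, h2⟩ => hr ⟨y, x, h2, h1⟩
      rw [hP' u v hr, hP' v u hr']
      rcases lt_or_gt_of_ne huv with h1 | h1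
      · exact Or.inl ⟨h1, h1.not_gt⟩
      · exact Or.inr ⟨h1, h1.not_gt⟩
  · intro u v h
    simp only [Finset.mem_filter, Finset.mem_univ, true_and] at h
    exact ⟨h.1, by omega⟩
  · ext ⟨x, y⟩
    simp only [Finset.mem_filter, Finset.mem_univ, true_and, OrderEmbedding.coe_ofStrictMono,
      hlt, heq, hP, ne_eq, hmono.injective.eq_iff]
    constructor
    · intro h
      obtain ⟨h1, h2⟩ := hT.only x y h
      exact ⟨h1, h2.lt_or_eq.imp id fun h3 => ⟨h3, h⟩⟩
    · rintro ⟨h1, h2 | h2⟩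
      · exact hT.short x y h1 h2
      · exact h2.2

theorem ConstructionRun.nonempty {N : ℕ} {T : Finset (Fin N × Fin N)}
    (hT : IsRequestTournament T) : Nonempty (ConstructionRun N T) := by
  -- consecutive integers that are `1` or `3` modulo `6` differ by at most `4`
  obtain ⟨p, hp, h1, h2⟩ : ∃ p, (p % 6 = 1 ∨ p % 6 = 3) ∧ 4 * p + N % 2 ≤ N + 14 ∧
      N ≤ 4 * p + N % 2 := by
    obtain ⟨q, hq⟩ : ∃ q, q = (N + 2) / 4 := ⟨_, rfl⟩
    have : q % 6 < 6 := Nat.mod_lt _ (by norm_num)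
    interval_cases hr : q % 6
    · exact ⟨q + 1, by omega⟩
    · exact ⟨q, by omega⟩
    · exact ⟨q + 1, by omega⟩
    · exact ⟨q, by omega⟩
    · exact ⟨q + 3, by omega⟩
    · exact ⟨q + 2, by omega⟩
  obtain ⟨f, T', hT', h⟩ := hT.exists_extension
    (show N + 2 * ((4 * p + N % 2 - N) / 2) = 4 * p + N % 2 by omega)
  obtain ⟨S⟩ := SteinerTripleSystem.nonempty_of_mod hp
  exact ⟨⟨p, hp, h1, S, f, T', hT', h⟩⟩

/-! ### Deletion of the dummy vertices -/

theorem ConstructionRun.mem_iff {N : ℕ} {T : Finset (Fin N × Fin N)} (R : ConstructionRun N T)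
    (a : Fin N × Fin N) : a ∈ T ↔ (R.f a.1, R.f a.2) ∈ R.T' := by
  have := Finset.ext_iff.mp R.restrict_eq a
  simpa using this

theorem ConstructionRun.mem_family_E {N : ℕ} {T : Finset (Fin N × Fin N)}
    (R : ConstructionRun N T) (w) (a : Fin N × Fin N) :
    a ∈ (R.family w).E ↔ (R.f a.1, R.f a.2) ∈ (construction R.S R.T' w).E := by
  simp [ConstructionRun.family, FinDigraph.restrict]

theorem ConstructionRun.valid {N : ℕ} {T : Finset (Fin N × Fin N)} (R : ConstructionRun N T) :
    IsValidPartition 2 T R.family := by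
  have h := construction_valid (Nat.mod_lt N two_pos) R.S R.request
  refine ⟨fun w => (h.admissible w).restrict R.f.strictMono, fun w a ha => ?_, fun a ha => ?_⟩
  · rw [R.mem_iff]
    exact h.subset w ((R.mem_family_E w a).mp ha)
  · simp only [R.mem_family_E]
    exact h.cover _ ((R.mem_iff a).mp ha)

theorem SteinerTripleSystem.card_blocks_mem_le {p : ℕ} (S : SteinerTripleSystem p) (i : Fin p) :
    (Finset.univ.filter fun b : {b // b ∈ S.blocks} => i ∈ b.1).card ≤ p := by
  have h : ∀ b : {b // b ∈ S.blocks}, ∃ j ∈ b.1, j ≠ i := fun b =>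
    Finset.exists_mem_ne (by rw [S.card_eq b.1 b.2]; norm_num) i
  choose g hg hgi using h
  calc _ ≤ (Finset.univ : Finset (Fin p)).card := by
        refine Finset.card_le_card_of_injOn g (fun _ _ => Finset.mem_coe.mpr (Finset.mem_univ _)) ?_
        intro b hb b' hb' hbb
        simp only [Finset.coe_filter, Finset.mem_univ, true_and, Set.mem_ofPred_eq] at hb hb'
        exact Subtype.ext ((S.unique i (g b) (hgi b).symm).unique ⟨b.2, hb, hg b⟩
          ⟨b'.2, hb', hbb ▸ hg b'⟩)
    _ = p := by simp

/-- A vertex lies in `O(p)` digraphs of the construction. -/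
theorem card_construction_mem_le {p t : ℕ} (S : SteinerTripleSystem p)
    (T : Finset (Fin (4 * p + t) × Fin (4 * p + t))) (x : Fin (4 * p + t)) :
    (Finset.univ.filter fun w => x ∈ (construction S T w).V).card ≤ 8 * p := by
  obtain ⟨s, hs, hsx⟩ : ∃ s : Finset {b // b ∈ S.blocks}, s.card ≤ p ∧
      ∀ b m, x ∈ (construction S T (Sum.inl (b, m))).V → b ∈ s := by
    have key : ∀ b m, x ∈ (construction S T (Sum.inl (b, m))).V →
        ∃ L i, x = ringVertex p t L i ∧ i ∈ b.1 := by
      intro b m h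
      rw [construction_inl] at h
      obtain ⟨z, -, rfl⟩ := Finset.mem_image.mp h
      obtain ⟨L, c, rfl⟩ := exists_eq_k444Vertex z
      exact ⟨L, _, blockVertex_k444Vertex _ _ _, S.enum_mem b c⟩
    rcases Nat.lt_or_ge x.val (4 * p) with hx | hx
    · obtain ⟨L, i, rfl⟩ := exists_eq_ringVertex x hx
      refine ⟨_, S.card_blocks_mem_le i, fun b m h => ?_⟩
      obtain ⟨L', i', e, hi⟩ := key b m h
      rw [(ringVertex_inj.mp e).2]
      simpa using hi
    · refine ⟨∅, by simp, fun b m h => ?_⟩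
      obtain ⟨L, i, rfl, -⟩ := key b m h
      exact absurd hx (not_le.mpr (ringVertex_val_lt L i))
  calc _ ≤ ((s ×ˢ (Finset.univ : Finset (Fin 4 ⊕ Fin 2))).disjSum
        (Finset.univ : Finset (Fin p × Fin 2))).card := by
        refine Finset.card_le_card ?_
        rintro (⟨b, m⟩ | w) h
        · simpa using hsx b m (by simpa using h)
        · simp
    _ = s.card * 6 + p * 2 := by
        rw [Finset.card_disjSum, Finset.card_product]
        simp
    _ ≤ 8 * p := by omega

theorem ConstructionRun.cost_le {N : ℕ} {T : Finset (Fin N × Fin N)} (R : ConstructionRun N T) :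
    cost R.family ≤ cost (construction R.S R.T') := by
  refine Finset.sum_le_sum fun w _ => Finset.card_le_card_of_injOn R.f ?_ R.f.injective.injOn
  intro x hx
  simpa [ConstructionRun.family, FinDigraph.restrict] using hx

theorem ConstructionRun.le_cost {N : ℕ} {T : Finset (Fin N × Fin N)} (R : ConstructionRun N T) :
    cost (construction R.S R.T') ≤ cost R.family + 112 * R.p := by
  classical
  let D := (Finset.univ.image R.f)ᶜ
  have hD : D.card ≤ 14 := by
    have := R.dummies
    rw [Finset.card_compl, Finset.card_image_of_injective _ R.f.injective]
    simp
    omega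
  have h1 : ∀ w, (construction R.S R.T' w).V.card ≤
      (R.family w).V.card + (D.filter fun x => x ∈ (construction R.S R.T' w).V).card := by
    intro w
    rw [← Finset.card_image_of_injective (R.family w).V R.f.injective]
    refine le_trans (Finset.card_le_card ?_) (Finset.card_union_le _ _)
    intro x hx
    by_cases h : ∃ y, R.f y = x
    · obtain ⟨y, rfl⟩ := h
      refine Finset.mem_union_left _ (Finset.mem_image_of_mem _ ?_)
      simpa [ConstructionRun.family, FinDigraph.restrict] using hx
    · exact Finset.mem_union_right _ (Finset.mem_filter.mpr ⟨by simpa [D] using h, hx⟩)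
  calc cost (construction R.S R.T')
      ≤ cost R.family + ∑ w, (D.filter fun x => x ∈ (construction R.S R.T' w).V).card := by
        unfold cost
        rw [← Finset.sum_add_distrib]
        exact Finset.sum_le_sum fun w _ => h1 w
    _ = cost R.family +
        ∑ x ∈ D, (Finset.univ.filter fun w => x ∈ (construction R.S R.T' w).V).card := by
        congr 1
        simp only [Finset.card_filter]
        exact Finset.sum_comm
    _ ≤ cost R.family + ∑ x ∈ D, 8 * R.p := by
        gcongr with x
        exact card_construction_mem_le R.S R.T' x
    _ ≤ cost R.family + 112 * R.p := by
        rw [Finset.sum_const, smul_eq_mul]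
        have := Nat.mul_le_mul_right (8 * R.p) hD
        omega

theorem ConstructionRun.abs_cost_sub_le {N : ℕ} {T : Finset (Fin N × Fin N)} (hN : 1 ≤ N)
    (R : ConstructionRun N T) :
    |(cost R.family : ℝ) - 34 * (N : ℝ) ^ 2 / 96| ≤ (1000 : ℝ) * N := by
  have h1 := six_mul_cost_construction (Nat.mod_lt N two_pos) R.S R.T'
  have h2 : (cost R.family : ℝ) ≤ cost (construction R.S R.T') := by exact_mod_cast R.cost_le
  have h3 : (cost (construction R.S R.T') : ℝ) ≤ cost R.family + 112 * R.p := by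
    exact_mod_cast R.le_cost
  have h4 : (4 * R.p + (N % 2 : ℕ) : ℝ) ≤ N + 14 := by exact_mod_cast R.dummies
  have h5 : (N : ℝ) ≤ 4 * R.p + (N % 2 : ℕ) := by
    have := Fintype.card_le_of_injective R.f R.f.injective
    simp only [Fintype.card_fin] at this
    exact_mod_cast this
  have ht : ((N % 2 : ℕ) : ℝ) ≤ 1 := by exact_mod_cast Nat.lt_succ_iff.mp (Nat.mod_lt N two_pos)
  have ht0 : (0 : ℝ) ≤ (N % 2 : ℕ) := Nat.cast_nonneg _
  have hN' : (1 : ℝ) ≤ N := by exact_mod_cast hN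
  have hp0 : (0 : ℝ) ≤ R.p := Nat.cast_nonneg _
  generalize ((N % 2 : ℕ) : ℝ) = t at *
  generalize (cost (construction R.S R.T') : ℝ) = c at *
  generalize (R.p : ℝ) = p at *
  rw [abs_le]
  have h6 : t * p ≤ p := by nlinarith
  have h7 : 0 ≤ t * p := by positivity
  constructor
  · have : ((N : ℝ) - 1) * (N - 1) ≤ (4 * p) * (4 * p) :=
      mul_le_mul (by linarith) (by linarith) (by linarith) (by linarith)
    nlinarith
  · have : (4 * p) * (4 * p) ≤ ((N : ℝ) + 14) * (N + 14) :=
      mul_le_mul (by linarith) (by linarith) (by linarith) (by linarith)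
    nlinarith

/-! ### The number of arcs and the total load of a request tournament -/

theorem sq_le_four_mul_sum_min (N : ℕ) :
    N ^ 2 ≤ 4 * ∑ q ∈ Finset.range N, min q (N - q) + 1 := by
  induction N using Nat.strong_induction_on with
  | _ N ih =>
    rcases N with _ | _ | N
    · simp
    · simp
    · have h : ∑ q ∈ Finset.range (N + 2), min q (N + 2 - q) =
          ∑ q ∈ Finset.range N, min q (N - q) + (N + 1) := by
        rw [Finset.sum_range_succ', Finset.sum_range_succ]
        have : ∀ q ∈ Finset.range N, min (q + 1) (N + 2 - (q + 1)) = min q (N - q) + 1 := by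
          intro q hq
          have := Finset.mem_range.mp hq
          omega
        rw [Finset.sum_congr rfl this, Finset.sum_add_distrib]
        simp
        omega
      rw [h]
      nlinarith [ih N (by omega)]

/-- A sum over the ordered pairs of distinct vertices splits into the sums over a request tournament
and over its converse. -/
theorem IsRequestTournament.two_mul_sum {N : ℕ} {T : Finset (Fin N × Fin N)}
    (hT : IsRequestTournament T) (g : Fin N → Fin N → ℕ) (hg : ∀ u v, g u v = g v u)
    (hg0 : ∀ u, g u u = 0) : 2 * ∑ a ∈ T, g a.1 a.2 = ∑ u, ∑ v, g u v := by
  classical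
  have hd : Disjoint T (T.image Prod.swap) := by
    rw [Finset.disjoint_left]
    rintro ⟨u, v⟩ h h'
    obtain ⟨⟨x, y⟩, hxy, e⟩ := Finset.mem_image.mp h'
    simp only [Prod.swap_prod_mk, Prod.mk.injEq] at e
    obtain ⟨rfl, rfl⟩ := e
    exact hT.swap_notMem h hxy
  have hs : ∑ a ∈ T.image Prod.swap, g a.1 a.2 = ∑ a ∈ T, g a.1 a.2 := by
    rw [Finset.sum_image Prod.swap_injective.injOn]
    exact Finset.sum_congr rfl fun a _ => hg _ _
  rw [two_mul]
  nth_rw 2 [← hs]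
  rw [← Finset.sum_union hd, ← Finset.sum_product' (f := g)]
  refine Finset.sum_subset (fun _ _ => by simp) ?_
  rintro ⟨u, v⟩ - h
  by_cases huv : u = v
  · rw [huv]
    exact hg0 v
  · refine absurd ?_ h
    rcases hT.mem_or_mem huv with h1 | h1
    · exact Finset.mem_union_left _ h1
    · exact Finset.mem_union_right _ (Finset.mem_image.mpr ⟨(v, u), h1, rfl⟩)

theorem IsRequestTournament.card {N : ℕ} {T : Finset (Fin N × Fin N)}
    (hT : IsRequestTournament T) : 2 * T.card + N = N ^ 2 := by
  have h := hT.two_mul_sum (fun u v => if u = v then 0 else 1) (fun u v => by simp only [eq_comm])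
    (fun u => by simp)
  rw [Finset.sum_congr rfl (g := fun _ => 1) fun a ha => if_neg (hT.only a.1 a.2 ha).1] at h
  have h' : ∀ u : Fin N, (∑ v, if u = v then 0 else 1) + 1 = N := fun u => by
    have h1 : ∑ v : Fin N, (if u = v then 1 else 0) = 1 := by simp
    nth_rw 2 [← h1]
    rw [← Finset.sum_add_distrib, Finset.sum_congr rfl (g := fun _ => 1) fun v _ => by
      split_ifs <;> rfl]
    simp
  have h2 : ∑ u : Fin N, ((∑ v, if u = v then 0 else 1) + 1) = N * N := by
    rw [Finset.sum_congr rfl fun u _ => h' u]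
    simp
  rw [Finset.sum_add_distrib] at h2
  simp only [Finset.sum_const, Finset.card_univ, Fintype.card_fin, smul_eq_mul, mul_one] at h h2
  rw [h, h2, sq]

theorem IsRequestTournament.cube_le_sum_cycleDist {N : ℕ} {T : Finset (Fin N × Fin N)}
    (hT : IsRequestTournament T) : N ^ 3 ≤ 8 * ∑ a ∈ T, cycleDist a.1 a.2 + N := by
  have h := hT.two_mul_sum (fun u v => min (cycleDist u v) (N - cycleDist u v))
    (fun u v => by
      by_cases huv : u = v
      · rw [huv]
      · have := cycleDist_add_cycleDist huv
        omega) (fun u => by simp [cycleDist_self])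
  rw [Finset.sum_congr rfl (g := fun a => cycleDist a.1 a.2) fun a ha => by
      have := (hT.only a.1 a.2 ha).2
      omega,
    Finset.sum_congr rfl fun u _ => sum_cycleDist u fun q => min q (N - q)] at h
  simp only [Finset.sum_const, Finset.card_univ, Fintype.card_fin, smul_eq_mul] at h
  have := Nat.mul_le_mul_left N (sq_le_four_mul_sum_min N)
  nlinarith

theorem sum_load {N : ℕ} (B : FinDigraph (Fin N)) :
    ∑ e, load B e = ∑ a ∈ B.E, cycleDist a.1 a.2 := by
  simp only [load, Finset.card_filter]
  rw [Finset.sum_comm]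
  refine Finset.sum_congr rfl fun a _ => ?_
  rw [sum_cycleDist a.1 fun q => if q < cycleDist a.1 a.2 then 1 else 0, ← Finset.card_filter]
  have : (Finset.range N).filter (fun q => q < cycleDist a.1 a.2) =
      Finset.range (cycleDist a.1 a.2) := by
    ext q
    have := cycleDist_lt a.1 a.2
    simp only [Finset.mem_filter, Finset.mem_range]
    omega
  rw [this, Finset.card_range]

/-! ### Arcs and vertices of a digraph of load at most two -/

/-- Counting the load on the ring arcs that leave the vertices of `B`: an arc of `B` loads one of
them or more, and only one arc per initial vertex loads exactly one. -/
theorem Admissible.two_mul_card_le {N : ℕ} {B : FinDigraph (Fin N)} (hB : Admissible 2 B)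
    (hE : ∀ a ∈ B.E, a.1 ≠ a.2) : 2 * B.E.card ≤ 3 * B.V.card := by
  let c : Fin N × Fin N → ℕ := fun a =>
    (B.V.filter fun x => cycleDist a.1 x < cycleDist a.1 a.2).card
  have h1 : ∑ a ∈ B.E, c a ≤ 2 * B.V.card := by
    calc ∑ a ∈ B.E, c a = ∑ x ∈ B.V, load B x := by
          simp only [c, load, Finset.card_filter]
          exact Finset.sum_comm
      _ ≤ ∑ x ∈ B.V, 2 := Finset.sum_le_sum fun x _ => hB x
      _ = 2 * B.V.card := by simp [mul_comm]
  have hzero : ∀ a : Fin N × Fin N, ∀ x, cycleDist a.1 x = 0 → x = a.1 := fun a x hx =>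
    cycleDist_injective a.1 (hx.trans (cycleDist_self a.1).symm)
  have hself : ∀ a ∈ B.E, cycleDist a.1 a.1 < cycleDist a.1 a.2 := by
    intro a ha
    rw [cycleDist_self]
    exact Nat.pos_of_ne_zero fun h => hE a ha (hzero a _ h).symm
  have hmem : ∀ a ∈ B.E, a.1 ∈ B.V.filter fun x => cycleDist a.1 x < cycleDist a.1 a.2 :=
    fun a ha => Finset.mem_filter.mpr ⟨(B.endpoints a ha).1, hself a ha⟩
  have h2 : (B.E.filter fun a => c a = 1).card ≤ B.V.card := by
    refine Finset.card_le_card_of_injOn Prod.fst ?_ ?_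
    · intro a ha
      exact (B.endpoints a (Finset.mem_filter.mp ha).1).1
    · -- of two arcs with the same initial vertex, the longer one passes the end of the shorter one
      have key : ∀ a ∈ B.E, ∀ b ∈ B.E, a.1 = b.1 → c b = 1 →
          ¬ cycleDist a.1 a.2 < cycleDist a.1 b.2 := by
        intro a ha b hb hab hc hlt
        have := Finset.card_le_one.mp hc.le b.1 (hmem b hb) a.2
          (Finset.mem_filter.mpr ⟨(B.endpoints a ha).2, hab ▸ hlt⟩)
        exact hE a ha (hab.trans this)
      rintro a ha b hb hab
      obtain ⟨ha, hca⟩ := Finset.mem_filter.mp ha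
      obtain ⟨hb, hcb⟩ := Finset.mem_filter.mp hb
      have h3 := key a ha b hb hab hcb
      have h4 := key b hb a ha hab.symm hca
      rw [← hab] at h4
      exact Prod.ext hab (cycleDist_injective a.1 (by omega))
  have h3 : ∑ a ∈ B.E, 2 ≤ ∑ a ∈ B.E, (c a + if c a = 1 then 1 else 0) := by
    refine Finset.sum_le_sum fun a ha => ?_
    have : 0 < c a := Finset.card_pos.mpr ⟨_, hmem a ha⟩
    split_ifs <;> omega
  rw [Finset.sum_add_distrib, ← Finset.card_filter, Finset.sum_const, smul_eq_mul] at h3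
  omega

/-- Every orientation of `K₄` has load at least three somewhere on the ring with 4 vertices. -/
theorem exists_three_le_load_of_tournament (s : Fin 6 → Bool) : ∃ e : Fin 4, 3 ≤
    (({if s 0 then (0, 1) else (1, 0), if s 1 then (0, 2) else (2, 0),
      if s 2 then (0, 3) else (3, 0), if s 3 then (1, 2) else (2, 1),
      if s 4 then (1, 3) else (3, 1), if s 5 then (2, 3) else (3, 2)} :
        Finset (Fin 4 × Fin 4)).filter fun a => cycleDist a.1 e < cycleDist a.1 a.2).card := by
  revert s
  decide +kernel

theorem not_admissible_of_tournament {B : FinDigraph (Fin 4)}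
    (h : ∀ u v, u ≠ v → (u, v) ∈ B.E ∨ (v, u) ∈ B.E) : ¬ Admissible 2 B := by
  intro hB
  obtain ⟨e, he⟩ := exists_three_le_load_of_tournament
    ![decide ((0, 1) ∈ B.E), decide ((0, 2) ∈ B.E), decide ((0, 3) ∈ B.E),
      decide ((1, 2) ∈ B.E), decide ((1, 3) ∈ B.E), decide ((2, 3) ∈ B.E)]
  refine absurd (he.trans (Finset.card_le_card (Finset.filter_subset_filter _ ?_)))
    (not_le.mpr (Nat.lt_succ_of_le (hB e)))
  have key : ∀ u v, u ≠ v → (if decide ((u, v) ∈ B.E) = true then (u, v) else (v, u)) ∈ B.E := by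
    intro u v huv
    by_cases h1 : (u, v) ∈ B.E
    · simp [h1]
    · simpa [h1] using h u v huv
  intro a ha
  simp only [Finset.mem_insert, Finset.mem_singleton] at ha
  rcases ha with rfl | rfl | rfl | rfl | rfl | rfl
  · exact key 0 1 (by decide)
  · exact key 0 2 (by decide)
  · exact key 0 3 (by decide)
  · exact key 1 2 (by decide)
  · exact key 1 3 (by decide)
  · exact key 2 3 (by decide)

/-- The inequality behind the lower bound. It is tight for 3, 4, 5 and 6 vertices, with 3, 5, 7 and
9 arcs. -/
theorem Admissible.card_add_three_le {N : ℕ} {T : Finset (Fin N × Fin N)}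
    (hT : IsRequestTournament T) {B : FinDigraph (Fin N)} (hB : Admissible 2 B) (hBT : B.E ⊆ T)
    (hne : B.E.Nonempty) : B.E.card + 3 ≤ 2 * B.V.card := by
  classical
  have hE : ∀ a ∈ B.E, a.1 ≠ a.2 := fun a ha => (hT.only a.1 a.2 (hBT ha)).1
  have h1 := hB.two_mul_card_le hE
  have hd : Disjoint B.E (B.E.image Prod.swap) := by
    rw [Finset.disjoint_left]
    rintro ⟨u, v⟩ h h'
    obtain ⟨⟨x, y⟩, hxy, e⟩ := Finset.mem_image.mp h'
    simp only [Prod.swap_prod_mk, Prod.mk.injEq] at e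
    obtain ⟨rfl, rfl⟩ := e
    exact hT.swap_notMem (hBT h) (hBT hxy)
  have hsub : B.E ∪ B.E.image Prod.swap ⊆ B.V.offDiag := by
    rintro ⟨u, v⟩ h
    rw [Finset.mem_offDiag]
    rcases Finset.mem_union.mp h with h | h
    · exact ⟨(B.endpoints _ h).1, (B.endpoints _ h).2, hE _ h⟩
    · obtain ⟨⟨x, y⟩, hxy, e⟩ := Finset.mem_image.mp h
      simp only [Prod.swap_prod_mk, Prod.mk.injEq] at e
      obtain ⟨rfl, rfl⟩ := e
      exact ⟨(B.endpoints _ hxy).2, (B.endpoints _ hxy).1, (hE _ hxy).symm⟩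
  have hcard : (B.E ∪ B.E.image Prod.swap).card = 2 * B.E.card := by
    rw [Finset.card_union_of_disjoint hd, Finset.card_image_of_injective _ Prod.swap_injective,
      two_mul]
  have h2 := Finset.card_le_card hsub
  rw [hcard, Finset.offDiag_card] at h2
  have h3 : 0 < B.E.card := hne.card_pos
  by_contra hlt
  have h4 : B.V.card ≤ 5 := by omega
  have h5 : B.V.card = 4 ∧ B.E.card = 6 := by
    interval_cases B.V.card <;> omega
  -- with 4 vertices and 6 arcs, `B` would be an orientation of `K₄`
  have hall : B.E ∪ B.E.image Prod.swap = B.V.offDiag :=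
    Finset.eq_of_subset_of_card_le hsub (by rw [hcard, Finset.offDiag_card, h5.1, h5.2])
  refine not_admissible_of_tournament ?_
    (hB.restrict (B.V.orderEmbOfFin h5.1).strictMono)
  intro u v huv
  have hmem : (B.V.orderEmbOfFin h5.1 u, B.V.orderEmbOfFin h5.1 v) ∈
      B.E ∪ B.E.image Prod.swap := by
    rw [hall, Finset.mem_offDiag]
    exact ⟨Finset.orderEmbOfFin_mem _ _ _, Finset.orderEmbOfFin_mem _ _ _,
      fun h => huv ((B.V.orderEmbOfFin h5.1).injective h)⟩
  simp only [FinDigraph.restrict, Finset.mem_filter, Finset.mem_univ, true_and]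
  rcases Finset.mem_union.mp hmem with h | h
  · exact Or.inl h
  · obtain ⟨⟨x, y⟩, hxy, e⟩ := Finset.mem_image.mp h
    simp only [Prod.swap_prod_mk, Prod.mk.injEq] at e
    exact Or.inr (by rw [← e.1, ← e.2]; exact hxy)

/-! ### The lower bound -/

theorem IsValidPartition.sum_sum {N C : ℕ} {ι : Type*} [Fintype ι] {T : Finset (Fin N × Fin N)}
    {B : ι → FinDigraph (Fin N)} (h : IsValidPartition C T B) (g : Fin N × Fin N → ℕ) :
    ∑ w, ∑ a ∈ (B w).E, g a = ∑ a ∈ T, g a := by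
  classical
  rw [← Finset.sum_biUnion]
  · refine Finset.sum_congr (Finset.ext fun a => ?_) fun _ _ => rfl
    simp only [Finset.mem_biUnion, Finset.mem_univ, true_and]
    exact ⟨fun ⟨w, hw⟩ => h.subset w hw, fun ha => (h.cover a ha).exists⟩
  · intro w _ w' _ hne
    rw [Function.onFun, Finset.disjoint_left]
    exact fun a ha ha' => hne ((h.cover a (h.subset w ha)).unique ha ha')

theorem IsValidPartition.le_cost {N : ℕ} {ι : Type*} [Fintype ι] {T : Finset (Fin N × Fin N)}
    (hT : IsRequestTournament T) {B : ι → FinDigraph (Fin N)} (h : IsValidPartition 2 T B) :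
    11 * N ^ 2 ≤ 32 * cost B + 8 * N + 3 := by
  classical
  rcases Nat.eq_zero_or_pos N with rfl | hN
  · simp
  let W := Finset.univ.filter fun w => (B w).E.Nonempty
  have hsum : ∀ g : Fin N × Fin N → ℕ, ∑ w ∈ W, ∑ a ∈ (B w).E, g a = ∑ a ∈ T, g a := by
    intro g
    rw [← h.sum_sum g]
    refine Finset.sum_subset (Finset.subset_univ _) fun w _ hw => ?_
    have : (B w).E = ∅ := by simpa [W, Finset.not_nonempty_iff_eq_empty] using hw
    rw [this, Finset.sum_empty]
  -- the total load bounds the number of digraphs with an arc from below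
  have h1 : ∑ a ∈ T, cycleDist a.1 a.2 ≤ W.card * (2 * N) := by
    rw [← hsum fun a => cycleDist a.1 a.2]
    refine Finset.sum_le_card_nsmul _ _ _ fun w _ => ?_
    rw [← sum_load]
    refine (Finset.sum_le_sum fun e _ => h.admissible w e).trans ?_
    simp [mul_comm]
  have h2 := hT.cube_le_sum_cycleDist
  have h3 : N ^ 2 ≤ 16 * W.card + 1 := by
    refine Nat.le_of_mul_le_mul_left ?_ hN
    nlinarith
  have h4 : T.card + 3 * W.card ≤ 2 * cost B := by
    calc T.card + 3 * W.card = ∑ w ∈ W, ((B w).E.card + 3) := by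
          have := hsum fun _ => 1
          simp only [Finset.sum_const, smul_eq_mul, mul_one] at this
          rw [Finset.sum_add_distrib, this, Finset.sum_const, smul_eq_mul, mul_comm]
      _ ≤ ∑ w ∈ W, 2 * (B w).V.card := Finset.sum_le_sum fun w hw =>
          (h.admissible w).card_add_three_le hT (h.subset w) (Finset.mem_filter.mp hw).2
      _ ≤ ∑ w, 2 * (B w).V.card :=
          Finset.sum_le_sum_of_subset (Finset.subset_univ _)
      _ = 2 * cost B := by rw [cost, Finset.mul_sum]
  have h5 := hT.card
  omega

theorem IsValidPartition.minADM_ge {N : ℕ} {ι : Type*} [Fintype ι] {T : Finset (Fin N × Fin N)}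
    (hT : IsRequestTournament T) {B : ι → FinDigraph (Fin N)} (h : IsValidPartition 2 T B) :
    11 * N ^ 2 ≤ 32 * minADM 2 N + 8 * N + 3 := by
  have hne : {n | ∃ T : Finset (Fin N × Fin N), IsRequestTournament T ∧
      ∃ (W : ℕ) (B : Fin W → FinDigraph (Fin N)), IsValidPartition 2 T B ∧ cost B = n}.Nonempty := by
    let e := (Fintype.equivFin ι).symm
    refine ⟨_, T, hT, _, fun w => B (e w), ⟨fun w => h.admissible _, fun w => h.subset _,
      fun a ha => ?_⟩, rfl⟩
    obtain ⟨w, hw, hu⟩ := h.cover a ha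
    refine ⟨e.symm w, by simpa using hw, fun w' hw' => ?_⟩
    rw [← hu _ hw', Equiv.symm_apply_apply]
  obtain ⟨T', hT', W, B', hB', hc⟩ := Nat.sInf_mem hne
  have := hB'.le_cost hT'
  rw [hc] at this
  exact this

/-! ### Exact costs and the approximation ratio -/

theorem mainTheorem8 :
    -- the four `G₆`'s and two `G₅`'s validly partition the oriented `K_{4,4,4}`, with 34 vertices
    (IsValidPartition 2 k444Arcs (k444Family k444Vertex) ∧ cost (k444Family k444Vertex) = 34) ∧
    -- Steiner triple systems exist for `p ≡ 1, 3 (mod 6)`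
    (∀ p : ℕ, p % 6 = 1 ∨ p % 6 = 3 → Nonempty (SteinerTripleSystem p)) ∧
    -- the construction on `N = 4 p` and on `N = 4 p + 1` vertices, with its exact cost
    (∀ (p : ℕ) (S : SteinerTripleSystem p) (T : Finset (Fin (4 * p + 0) × Fin (4 * p + 0))),
      IsRequestTournament T →
        IsValidPartition 2 T (construction S T) ∧
        (cost (construction S T) : ℝ) = (34 * (4 * p : ℝ) ^ 2 + 8 * (4 * p : ℝ)) / 96) ∧
    (∀ (p : ℕ) (S : SteinerTripleSystem p) (T : Finset (Fin (4 * p + 1) × Fin (4 * p + 1))),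
      IsRequestTournament T →
        IsValidPartition 2 T (construction S T) ∧
        (cost (construction S T) : ℝ) =
          (34 * (4 * p + 1 : ℝ) ^ 2 - 12 * (4 * p + 1 : ℝ) - 22) / 96) ∧
    -- the construction can be run for every `N` and every request tournament `T_N`
    (∀ (N : ℕ) (T : Finset (Fin N × Fin N)), IsRequestTournament T →
      Nonempty (ConstructionRun N T)) ∧
    -- it yields a valid partition with `34 N² / 96 + O(N)` vertices
    (∃ K : ℝ, ∀ (N : ℕ) (T : Finset (Fin N × Fin N)), 1 ≤ N → IsRequestTournament T →
      ∀ R : ConstructionRun N T,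
        IsValidPartition 2 T R.family ∧
        |(cost R.family : ℝ) - 34 * (N : ℝ) ^ 2 / 96| ≤ K * N) ∧
    -- asymptotically it approximates `A(2, N)` within a factor `34 / 33`
    (∀ ε : ℝ, 0 < ε → ∃ N₀ : ℕ, ∀ (N : ℕ) (T : Finset (Fin N × Fin N)), N₀ ≤ N →
      IsRequestTournament T → ∀ R : ConstructionRun N T,
        (cost R.family : ℝ) ≤ (34 / 33 + ε) * (minADM 2 N : ℝ)) := by
  refine ⟨⟨⟨k444_admissible, k444_subset, k444_cover⟩, k444_card⟩,
    fun p hp => SteinerTripleSystem.nonempty_of_mod hp, fun p S T hT => ?_, fun p S T hT => ?_,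
    fun N T hT => ConstructionRun.nonempty hT, ⟨1000, fun N T hN hT R => ⟨R.valid,
      R.abs_cost_sub_le hN⟩⟩, fun ε hε => ?_⟩
  · have h := six_mul_cost_construction (by norm_num) S T
    refine ⟨construction_valid (by norm_num) S hT, ?_⟩
    push_cast at h
    linear_combination h / 6
  · have h := six_mul_cost_construction (by norm_num) S T
    refine ⟨construction_valid (by norm_num) S hT, ?_⟩
    push_cast at h
    linear_combination h / 6
  · -- `N` is large enough for `33 / 96 * ε * N` to outweigh the linear error terms
    obtain ⟨N₀, hN₀⟩ := exists_nat_ge (3 * (1002 + ε) / ε)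
    refine ⟨N₀ + 1, fun N T hN hT R => ?_⟩
    have h1 := (abs_le.mp (R.abs_cost_sub_le (by omega))).2
    have h2 : (11 : ℝ) * N ^ 2 ≤ 32 * minADM 2 N + 8 * N + 3 := by
      exact_mod_cast R.valid.minADM_ge hT
    have hN1 : (1 : ℝ) ≤ N := by exact_mod_cast (by omega : 1 ≤ N)
    have h3 : 3 * (1002 + ε) ≤ ε * N := by
      rw [div_le_iff₀ hε] at hN₀
      have : (N₀ : ℝ) ≤ N := by exact_mod_cast (by omega : N₀ ≤ N)
      nlinarith
    have h4 : (11 / 32 : ℝ) * N ^ 2 - 11 / 32 * N ≤ minADM 2 N := by linarith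
    have h5 := mul_le_mul_of_nonneg_left h4 (show 0 ≤ 34 / 33 + ε by positivity)
    have h6 : 3 * (1002 + ε) * N ≤ ε * N * N :=
      mul_le_mul_of_nonneg_right h3 (by linarith)
    have h7 : 0 ≤ ε * N := by positivity
    nlinarith
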